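/- **Notation.** For a field $f:\mathbb{R}^d\to\mathbb{C}$ of finite energy let $F(\omega)=\int_{\mathbb{R}^d} f(r)e^{-\mathrm{i}\langle\omega,r\rangle}\,dr$ be its ($L^2$) Fourier transform. For $\Omega\subset\mathbb{R}^d$ let $\mathcal{B}_\Omega$ be the set of (continuous) $f\in L^2(\mathbb{R}^d)$ with $F=0$ almost everywhere outside $\Omega$. A set $\Lambda\subset\mathbb{R}^d$ is uniformly discrete if there is $r>0$ with $\|x-y\|>r$ for all distinct $x,y\in\Lambda$; $\mathcal{A}_\Omega$ is the collection of the uniformly discrete sets $\Lambda$ such that every $f\in\mathcal{B}_\Omega$ is uniquely determined, among the members of $\mathcal{B}_\Omega$, by its values on $\Lambda$. A $\kappa$-manifold set in $\mathbb{R}^d$ is a countable collection $P$ of topological manifolds $M\subset\mathbb{R}^d$ (subspace topology) in which every point has a neighborhood homeomorphic to $\mathbb{R}^\kappa$. It is a *Nyquist $\kappa$-manifold set* for $\Omega$ if there is $\Lambda\in\mathcal{A}_\Omega$ all of whose points lie on the manifolds in $P$. For $s\in\mathbb{R}^d$ put $\Omega(s)=\{x\in\mathbb{R}^d: x-s\in\Omega\}$,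 and let $\overset{\circ}{\Omega}$ be the interior of $\Omega$. **Theorem.** Let $d\ge 1$ and let $\Omega\subset\mathbb{R}^d$ be compact and convex. Let $w_1,\dots,w_N\in\mathbb{R}^d$ be vectors, let $h_1,\dots,h_N\in\mathbb{R}^d$ be linearly independent unit vectors, and let $\Delta_1,\dots,\Delta_N>0$. Let $H_i=\{r\in\mathbb{R}^d:\langle r,h_i\rangle=0\}$ and $$P=\bigcup_{i=1}^N\{\,w_i+j\Delta_i h_i+H_i : j\in\mathbb{Z}\,\},$$ a union of $N$ sets of equispaced parallel hyperplanes. Put $u_i=2\pi h_i/\Delta_i$ and $$\mathcal{Q}=\Big\{\sum_{i=1}^N(-1)^{k_i}\frac{u_i}{2} : k_i\in\{0,1\},\ 1\le i\le N\Big\}.$$ Then $P$ is a $(d-1)$-manifold set, and 1. if $\mathcal{Q}\not\subset\Omega(s)$ for all $s\in\mathbb{R}^d$, then $P$ is a Nyquist $(d-1)$-manifold set for $\Omega$; 2. if $\mathcal{Q}\subset\overset{\circ}{\Omega}(s)$ for some $s\in\mathbb{R}^d$, then $P$ is not a Nyquist $(d-1)$-manifold set for $\Omega$. -/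

import Mathlib

open MeasureTheory Topology
open scoped FourierTransform

namespace HyperplaneSampling

/-- The `L²` Fourier transform on `ℝ^d` in the angular-frequency normalization
`F(ω) = ∫ f(r) exp(-i⟨ω, r⟩) dr`. Mathlib's transform has the kernel `exp(-2πi⟨ξ, r⟩)`, so
`F(ω)` is Mathlib's transform at `ξ = ω / (2π)`. -/
noncomputable def angularFourier {d : ℕ}
    (f : Lp ℂ 2 (volume : Measure (EuclideanSpace ℝ (Fin d)))) : EuclideanSpace ℝ (Fin d) → ℂ :=
  fun ω => (𝓕 f : Lp ℂ 2 (volume : Measure (EuclideanSpace ℝ (Fin d)))) ((2 * Real.pi)⁻¹ • ω)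

/-- The fields of finite energy on `ℝ^d` that are bandlimited to `Ω`: the functions `f ∈ L²(ℝ^d)`
whose Fourier transform vanishes (almost everywhere) outside `Ω`. A field is evaluated at points,
so it is the continuous representative of its `L²` class (unique, and existing whenever `Ω` is
bounded). -/
def Bandlimited {d : ℕ} (Ω : Set (EuclideanSpace ℝ (Fin d))) :
    Set (EuclideanSpace ℝ (Fin d) → ℂ) :=
  {f | Continuous f ∧ ∃ hf : MemLp f 2 (volume : Measure (EuclideanSpace ℝ (Fin d))),
    ∀ᵐ ω ∂(volume : Measure (EuclideanSpace ℝ (Fin d))),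
      ω ∉ Ω → angularFourier (hf.toLp f) ω = 0}

/-- A set of points is uniformly discrete if distinct points are at distance more than a fixed
`r > 0`. -/
def UniformlyDiscrete {d : ℕ} (Λ : Set (EuclideanSpace ℝ (Fin d))) : Prop :=
  ∃ r : ℝ, 0 < r ∧ ∀ x ∈ Λ, ∀ y ∈ Λ, x ≠ y → r < ‖x - y‖

/-- The uniformly discrete sets `Λ` such that every field bandlimited to `Ω` is uniquely
determined by its values on `Λ`. -/
def SamplingSets {d : ℕ} (Ω : Set (EuclideanSpace ℝ (Fin d))) :
    Set (Set (EuclideanSpace ℝ (Fin d))) :=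
  {Λ | UniformlyDiscrete Λ ∧
    ∀ f ∈ Bandlimited Ω, ∀ g ∈ Bandlimited Ω, (∀ x ∈ Λ, f x = g x) → f = g}

/-- A `κ`-manifold in `ℝ^d`: a subset `M` of `ℝ^d` (with the subspace topology) in which every
point has a neighborhood homeomorphic to `ℝ^κ`. -/
def IsManifoldIn {d : ℕ} (κ : ℕ) (M : Set (EuclideanSpace ℝ (Fin d))) : Prop :=
  ∀ x : M, ∃ U : Set M, U ∈ 𝓝 x ∧ Nonempty (U ≃ₜ EuclideanSpace ℝ (Fin κ))

/-- A `κ`-manifold set in `ℝ^d`: a countable collection of `κ`-manifolds in `ℝ^d`. -/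
def IsManifoldSet {d : ℕ} (κ : ℕ) (P : Set (Set (EuclideanSpace ℝ (Fin d)))) : Prop :=
  P.Countable ∧ ∀ M ∈ P, IsManifoldIn κ M

/-- The collection of Nyquist `κ`-manifold sets for `Ω`: the `κ`-manifold sets `P` such that some
uniformly discrete set of points on the manifolds in `P` determines every field bandlimited
to `Ω`. -/
def NyquistManifoldSets {d : ℕ} (κ : ℕ) (Ω : Set (EuclideanSpace ℝ (Fin d))) :
    Set (Set (Set (EuclideanSpace ℝ (Fin d)))) :=
  {P | IsManifoldSet κ P ∧ ∃ Λ : Set (EuclideanSpace ℝ (Fin d)), Λ ⊆ ⋃₀ P ∧ Λ ∈ SamplingSets Ω}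

/-- The hyperplane through the origin with normal vector `h`. -/
def originHyperplane {d : ℕ} (h : EuclideanSpace ℝ (Fin d)) : Set (EuclideanSpace ℝ (Fin d)) :=
  {r | inner ℝ r h = 0}

/-- The uniform hyperplane set with offset `w`, unit normal `h` and spacing `Δ`: the collection of
the hyperplanes `w + j Δ h + H`, `j ∈ ℤ`, where `H` is the hyperplane through the origin with
normal `h`. -/
def uniformHyperplaneSet {d : ℕ} (w h : EuclideanSpace ℝ (Fin d)) (Δ : ℝ) :
    Set (Set (EuclideanSpace ℝ (Fin d))) :=
  Set.range fun j : ℤ => (fun r => w + ((j : ℝ) * Δ) • h + r) '' originHyperplane h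

/-- The union of `N` uniform hyperplane sets (as a collection of hyperplanes). -/
def unionUniformHyperplaneSets {d N : ℕ} (w h : Fin N → EuclideanSpace ℝ (Fin d))
    (Δ : Fin N → ℝ) : Set (Set (EuclideanSpace ℝ (Fin d))) :=
  ⋃ i, uniformHyperplaneSet (w i) (h i) (Δ i)

/-- The vector `u = 2π h / Δ` along which the spectrum is repeated. -/
noncomputable def spectralShift {d : ℕ} (h : EuclideanSpace ℝ (Fin d)) (Δ : ℝ) :
    EuclideanSpace ℝ (Fin d) :=
  (2 * Real.pi / Δ) • h

/-- The set `𝒬` of the points `∑ i, (-1)^(k i) u i / 2` with `k i ∈ {0, 1}`, where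
`u i = 2π (h i) / (Δ i)`. -/
noncomputable def cornerSet {d N : ℕ} (h : Fin N → EuclideanSpace ℝ (Fin d)) (Δ : Fin N → ℝ) :
    Set (EuclideanSpace ℝ (Fin d)) :=
  {q | ∃ k : Fin N → Fin 2,
    q = ∑ i, (-1 : ℝ) ^ (k i : ℕ) • ((1 / 2 : ℝ) • spectralShift (h i) (Δ i))}

/-- The set `Ω` shifted by the vector `s`. -/
def shift {d : ℕ} (Ω : Set (EuclideanSpace ℝ (Fin d))) (s : EuclideanSpace ℝ (Fin d)) :
    Set (EuclideanSpace ℝ (Fin d)) :=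
  {x | x - s ∈ Ω}

end HyperplaneSampling

open scoped Pointwise

/-! In Mathlib's frequency normalization put `u i = h i / Δ i` and `K = Ω / 2π`; the hyperplanes of
family `i` are then the solutions of `⟪r - w i, u i⟫ ∈ ℤ`. The engine is division. If `f = 𝓕⁻ F` has
spectrum in the compact convex set `K` and vanishes on one family, then, after translating by `w i`,
the periodization of `F` along `u i` vanishes (`tsum_shift_eq_zero`). So `F = G - G(· + u i)` with
`G` a half-line sum, and convexity confines `G` to `K ∩ (K + u i)`. Hence `f` is `1 - exp(-2πi⟪u i,
r - w i⟫)` times a function of smaller spectrum (`HasSpectrumIn.exists_quotient`). By linear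
independence the quotient still vanishes on the other families, so a nonzero `f` vanishing on all of
them forces some `x` with `x - ∑ i ∈ T, u i ∈ K` for every `T` (`exists_forall_sub_sum_mem`). After
scaling by `2π`, these points form a translate of the corner set. Conversely, given room around such
points, a function with spectrum in a small ball times all the factors is a nonzero function
vanishing on every hyperplane (`exists_hasSpectrumIn_vanishing`). Passing from hyperplanes to
discrete points is a Bernstein argument: if `f` vanishes on a fine net of the hyperplanes, any bound
for `|f|` on their union can be halved, so `f` vanishes there (`exists_density_forall_eq_zero`). -/

namespace HyperplaneSampling

/-! ### Bandlimited fields as inverse Fourier integrals -/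

section Spectrum

variable {E : Type*} [NormedAddCommGroup E] [InnerProductSpace ℝ E] [FiniteDimensional ℝ E]
  [MeasurableSpace E] [BorelSpace E]

theorem continuous_fourierInv {F : E → ℂ} (hF : Integrable F) : Continuous (𝓕⁻ F : E → ℂ) := by
  have h : Continuous (𝓕 F : E → ℂ) :=
    VectorFourier.fourierIntegral_continuous Real.continuous_fourierChar
      (L := innerₗ E) (by exact continuous_inner) hF
  have h2 : (𝓕⁻ F : E → ℂ) = fun x => 𝓕 F (-x) := by
    ext x; exact Real.fourierInv_eq_fourier_neg F x
  rw [h2]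
  exact h.comp continuous_neg

theorem integral_smul_fourierInv_eq {φ F : E → ℂ} (hφ : Integrable φ) (hF : Integrable F) :
    ∫ x, φ x • 𝓕⁻ F x = ∫ x, 𝓕⁻ φ x • F x := by
  -- Negating the pairing turns the general Fourier integral into `𝓕⁻`.
  have := VectorFourier.integral_fourierIntegral_smul_eq_flip (L := - innerₗ E)
    (μ := volume) (ν := volume) Real.continuous_fourierChar
    (by exact (continuous_inner (𝕜 := ℝ) (E := E)).neg) hφ hF
  have e1 : ∀ G : E → ℂ, (𝓕⁻ G : E → ℂ) =
      VectorFourier.fourierIntegral Real.fourierChar volume (-innerₗ E) G := by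
    intro G; rfl
  have e2 : ∀ G : E → ℂ, (𝓕⁻ G : E → ℂ) =
      VectorFourier.fourierIntegral Real.fourierChar volume (-innerₗ E).flip G := by
    intro G; ext x
    simp [VectorFourier.fourierIntegral, Real.fourierInv_eq, real_inner_comm]
  rw [e1 φ, e2 F]
  exact this.symm

/-- Both sides have the same integrals against smooth compactly supported functions: these are
Schwartz, so the `L²` side can be computed as a tempered distribution and the other by Fubini. This
links the `L²` definition of bandlimitedness to pointwise integrals. -/
theorem coeFn_fourierInv_toLp {F : E → ℂ} (hF : Integrable F) (hF2 : MemLp F 2 volume) :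
    ((𝓕⁻ (hF2.toLp F) : Lp ℂ 2 (volume : Measure E)) : E → ℂ) =ᵐ[volume] 𝓕⁻ F := by
  apply ae_eq_of_integral_contDiff_smul_eq
  · exact (Lp.memLp _).locallyIntegrable (by norm_num)
  · exact (continuous_fourierInv hF).locallyIntegrable
  intro g g_smooth g_cpt
  have hg₁ : HasCompactSupport (Complex.ofRealCLM ∘ g) := g_cpt.comp_left rfl
  have hg₂ : ContDiff ℝ (⊤ : ℕ∞) (Complex.ofRealCLM ∘ g) :=
    Complex.ofRealCLM.contDiff.comp g_smooth
  set φ : SchwartzMap E ℂ := hg₁.toSchwartzMap hg₂ with hφ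
  have hφg : ∀ x, φ x = (g x : ℂ) := fun x => rfl
  have h1 := Lp.fourierInv_toTemperedDistribution_eq (hF2.toLp F)
  have h2 := congrArg (fun T => T φ) h1
  simp only [TemperedDistribution.fourierInv_apply, Lp.toTemperedDistribution_apply] at h2
  have h3 : ∫ x, (𝓕⁻ φ : SchwartzMap E ℂ) x • (hF2.toLp F) x = ∫ x, (𝓕⁻ (φ : E → ℂ)) x • F x := by
    apply integral_congr_ae
    filter_upwards [hF2.coeFn_toLp] with x hx
    rw [hx, SchwartzMap.fourierInv_coe]
  rw [h3, ← integral_smul_fourierInv_eq φ.integrable hF] at h2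
  simpa [hφg] using h2.symm

/-- `f` is the (inverse) Fourier transform of an integrable and square integrable function
vanishing outside `K`. -/
def HasSpectrumIn (K : Set E) (f : E → ℂ) : Prop :=
  ∃ F : E → ℂ, Integrable F ∧ MemLp F 2 volume ∧ (∀ ξ, ξ ∉ K → F ξ = 0) ∧ f = 𝓕⁻ F

theorem integrable_of_memLp_two_of_bounded {F : E → ℂ} (hF : MemLp F 2 volume) {K : Set E}
    (hK : Bornology.IsBounded K) (h0 : ∀ ξ, ξ ∉ K → F ξ = 0) : Integrable F := by
  rw [← memLp_one_iff_integrable]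
  exact hF.mono_exponent_of_measure_support_ne_top (s := K) h0 hK.measure_lt_top.ne (by norm_num)

end Spectrum

theorem hasSpectrumIn_of_bandlimited {d : ℕ} {Ω : Set (EuclideanSpace ℝ (Fin d))}
    (hb : Bornology.IsBounded Ω) (hm : MeasurableSet Ω) {f : EuclideanSpace ℝ (Fin d) → ℂ}
    (hf : f ∈ Bandlimited Ω) : HasSpectrumIn {ξ | (2 * Real.pi) • ξ ∈ Ω} f := by
  obtain ⟨hc, hL, h0⟩ := hf
  have hpi : (2 * Real.pi) ≠ 0 := by positivity
  set F₀ : Lp ℂ 2 (volume : Measure (EuclideanSpace ℝ (Fin d))) := 𝓕 (hL.toLp f) with hF₀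
  set K : Set (EuclideanSpace ℝ (Fin d)) := {ξ | (2 * Real.pi) • ξ ∈ Ω} with hK
  have hKm : MeasurableSet K := measurable_const_smul (2 * Real.pi) hm
  have hKb : Bornology.IsBounded K := by
    have : K = (2 * Real.pi)⁻¹ • Ω := by
      ext x; rw [Set.mem_inv_smul_set_iff₀ hpi]; rfl
    rw [this]; exact hb.smul₀ _
  -- Cutting off changes the spectrum only on a null set, but makes it vanish at every point outside
  -- `K`.
  have hF : K.indicator F₀ =ᵐ[volume] F₀ := by
    have hq : Measure.QuasiMeasurePreserving
        (fun ξ : EuclideanSpace ℝ (Fin d) => (2 * Real.pi) • ξ) volume volume := by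
      refine ⟨measurable_const_smul _, ?_⟩
      rw [Measure.map_addHaar_smul _ hpi]
      exact Measure.smul_absolutelyContinuous
    filter_upwards [hq.ae h0] with ξ hξ
    by_cases h : ξ ∈ K
    · simp [h]
    · have := hξ h
      simp only [angularFourier, smul_smul, inv_mul_cancel₀ hpi, one_smul] at this
      simp [h, hF₀, this]
  have hF2 : MemLp (K.indicator F₀) 2 volume := (Lp.memLp F₀).indicator hKm
  have hF0 : ∀ ξ, ξ ∉ K → K.indicator F₀ ξ = 0 := fun ξ h => Set.indicator_of_notMem h _
  have hF1 : Integrable (K.indicator F₀) := integrable_of_memLp_two_of_bounded hF2 hKb hF0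
  refine ⟨K.indicator F₀, hF1, hF2, hF0, ?_⟩
  have e : hF2.toLp _ = F₀ := by
    rw [Lp.ext_iff]; exact hF2.coeFn_toLp.trans hF
  have key := coeFn_fourierInv_toLp hF1 hF2
  rw [e, hF₀, FourierTransform.fourierInv_fourier_eq] at key
  exact Measure.eq_of_ae_eq (hL.coeFn_toLp.symm.trans key) hc (continuous_fourierInv hF1)

theorem bandlimited_of_hasSpectrumIn {d : ℕ} {Ω : Set (EuclideanSpace ℝ (Fin d))}
    {f : EuclideanSpace ℝ (Fin d) → ℂ}
    (hf : HasSpectrumIn {ξ | (2 * Real.pi) • ξ ∈ Ω} f) : f ∈ Bandlimited Ω := by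
  obtain ⟨F, hF1, hF2, hF0, rfl⟩ := hf
  have hpi : (2 * Real.pi) ≠ 0 := by positivity
  have key := coeFn_fourierInv_toLp hF1 hF2
  have hL : MemLp (𝓕⁻ F : EuclideanSpace ℝ (Fin d) → ℂ) 2 volume :=
    (memLp_congr_ae key).1 (Lp.memLp _)
  refine ⟨continuous_fourierInv hF1, hL, ?_⟩
  have e : hL.toLp _ = (𝓕⁻ (hF2.toLp F) : Lp ℂ 2 volume) := by
    rw [Lp.ext_iff]; exact hL.coeFn_toLp.trans key.symm
  have hq : Measure.QuasiMeasurePreserving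
      (fun ξ : EuclideanSpace ℝ (Fin d) => (2 * Real.pi)⁻¹ • ξ) volume volume := by
    refine ⟨measurable_const_smul _, ?_⟩
    rw [Measure.map_addHaar_smul _ (inv_ne_zero hpi)]
    exact Measure.smul_absolutelyContinuous
  filter_upwards [hq.ae hF2.coeFn_toLp] with ω hω hn
  simp only [angularFourier, e, FourierTransform.fourier_fourierInv_eq, hω]
  apply hF0
  change ¬ ((2 * Real.pi) • (2 * Real.pi)⁻¹ • ω ∈ Ω)
  rwa [smul_smul, mul_inv_cancel₀ hpi, one_smul]

/-! ### Densities annihilated by a family of characters -/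

section Uniqueness

open BoundedContinuousFunction

variable {X : Type*} [TopologicalSpace X] [PolishSpace X] [MeasurableSpace X] [BorelSpace X]

/-- Finite measures are determined by the integrals of a separating star-closed multiplicative
family of bounded continuous functions. -/
theorem measure_ext_of_submonoid {P P' : Measure X} [IsFiniteMeasure P] [IsFiniteMeasure P']
    (M : Submonoid (X →ᵇ ℂ)) (hstar : ∀ g ∈ M, star g ∈ M)
    (hsep : ∀ x y, x ≠ y → ∃ g ∈ M, g x ≠ g y)
    (h : ∀ g ∈ M, ∫ x, g x ∂P = ∫ x, g x ∂P') : P = P' := by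
  -- A multiplicative family spans its own algebra, so equality of integrals extends to the algebra
  -- by linearity.
  have hspan : ∀ g, g ∈ Algebra.adjoin ℂ (M : Set (X →ᵇ ℂ)) ↔
      g ∈ Submodule.span ℂ (M : Set (X →ᵇ ℂ)) := by
    intro g
    rw [← Subalgebra.mem_toSubmodule, Algebra.adjoin_eq_span, Submonoid.closure_eq]
  let A : StarSubalgebra ℂ (X →ᵇ ℂ) :=
    { toSubalgebra := Algebra.adjoin ℂ (M : Set (X →ᵇ ℂ))
      star_mem' := by
        intro g hg
        simp only [Subsemiring.coe_carrier_toSubmonoid, Subalgebra.coe_toSubsemiring,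
          SetLike.mem_coe] at hg ⊢
        rw [hspan] at hg ⊢
        induction hg using Submodule.span_induction with
        | mem x hx => exact Submodule.subset_span (hstar x hx)
        | zero => simp
        | add x y _ _ hx hy => rw [star_add]; exact Submodule.add_mem _ hx hy
        | smul a x _ hx => rw [star_smul]; exact Submodule.smul_mem _ _ hx }
  apply ext_of_forall_mem_subalgebra_integral_eq_of_polish (𝕜 := ℂ) (A := A)
  · intro x y hxy
    obtain ⟨g, hg, hne⟩ := hsep x y hxy
    refine ⟨g, ⟨g.toContinuousMap, ⟨g, Algebra.subset_adjoin hg, rfl⟩, rfl⟩, hne⟩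
  · intro g hg
    have hg' := (hspan g).1 hg
    induction hg' using Submodule.span_induction with
    | mem x hx => exact h x hx
    | zero => simp
    | add x y hx hy ihx ihy =>
      simp only [BoundedContinuousFunction.coe_add, Pi.add_apply]
      rw [integral_add (x.integrable _) (y.integrable _),
        integral_add (x.integrable _) (y.integrable _), ihx ((hspan x).2 hx),
        ihy ((hspan y).2 hy)]
    | smul a x hx ihx =>
      simp only [BoundedContinuousFunction.coe_smul]
      rw [integral_smul, integral_smul, ihx ((hspan x).2 hx)]

variable {Y : Type*} [MeasurableSpace Y] {μ : Measure Y}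

/-- The positive and negative parts of `φ` push forward under `T` to finite measures with equal
integrals over the family, hence to the same measure. -/
theorem setIntegral_preimage_eq_zero_real {φ : Y → ℝ} (hφ : Integrable φ μ) {T : Y → X}
    (hT : Measurable T) (M : Submonoid (X →ᵇ ℂ)) (hstar : ∀ g ∈ M, star g ∈ M)
    (hsep : ∀ x y, x ≠ y → ∃ g ∈ M, g x ≠ g y)
    (h : ∀ g ∈ M, ∫ y, (φ y : ℂ) * g (T y) ∂μ = 0) {B : Set X} (hB : MeasurableSet B) :
    ∫ y in T ⁻¹' B, φ y ∂μ = 0 := by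
  let ν (ψ : Y → ℝ) : Measure X := (μ.withDensity fun y => ENNReal.ofReal (ψ y)).map T
  have hfin : ∀ ψ : Y → ℝ, Integrable ψ μ →
      IsFiniteMeasure (μ.withDensity fun y => ENNReal.ofReal (ψ y)) := fun ψ hψ =>
    isFiniteMeasure_withDensity_ofReal hψ.2
  have hbd : ∀ (ψ : Y → ℝ), Integrable ψ μ → ∀ g : X →ᵇ ℂ,
      Integrable (fun y => (ψ y : ℂ) * g (T y)) μ := by
    intro ψ hψ g
    refine hψ.ofReal.mul_bdd (c := ‖g‖) ?_ ?_
    · exact (g.continuous.measurable.comp hT).aestronglyMeasurable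
    · exact Filter.Eventually.of_forall fun y => g.norm_coe_le_norm _
  have hint : ∀ ψ : Y → ℝ, Integrable ψ μ → ∀ g : X →ᵇ ℂ,
      ∫ x, g x ∂(ν ψ) = ∫ y, ((max (ψ y) 0 : ℝ) : ℂ) * g (T y) ∂μ := by
    intro ψ hψ g
    rw [integral_map hT.aemeasurable g.continuous.measurable.aestronglyMeasurable,
      integral_withDensity_eq_integral_toReal_smul₀ (by exact hψ.1.aemeasurable.ennreal_ofReal)
        (by simp)]
    refine integral_congr_ae (Filter.Eventually.of_forall fun y => ?_)
    simp [ENNReal.toReal_ofReal']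
  have := hfin φ hφ
  have := hfin (fun y => -φ y) hφ.neg
  have hP : ν φ = ν fun y => -φ y := by
    apply measure_ext_of_submonoid M hstar hsep
    intro g hg
    have i1 := hbd _ hφ.pos_part g
    have i2 : Integrable (fun y => ((max (-φ y) 0 : ℝ) : ℂ) * g (T y)) μ :=
      hbd _ hφ.neg.pos_part g
    rw [hint φ hφ, hint (fun y => -φ y) hφ.neg, ← sub_eq_zero, ← integral_sub i1 i2, ← h g hg]
    refine integral_congr_ae (Filter.Eventually.of_forall fun y => ?_)
    simp only
    rw [← sub_mul, ← Complex.ofReal_sub]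
    congr 2
    rcases le_total (φ y) 0 with h | h <;> simp [h]
  have hPB := congrArg (fun m => m B) hP
  simp only [ν, Measure.map_apply hT hB, withDensity_apply _ (hT hB)] at hPB
  rw [integral_eq_lintegral_pos_part_sub_lintegral_neg_part hφ.integrableOn, hPB, sub_self]

/-- A complex density annihilating the pullbacks of a separating star-closed multiplicative family
has vanishing integral on all pullbacks of measurable sets. -/
theorem setIntegral_preimage_eq_zero {F : Y → ℂ} (hF : Integrable F μ) {T : Y → X}
    (hT : Measurable T) (M : Submonoid (X →ᵇ ℂ)) (hstar : ∀ g ∈ M, star g ∈ M)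
    (hsep : ∀ x y, x ≠ y → ∃ g ∈ M, g x ≠ g y)
    (h : ∀ g ∈ M, ∫ y, F y * g (T y) ∂μ = 0) {B : Set X} (hB : MeasurableSet B) :
    ∫ y in T ⁻¹' B, F y ∂μ = 0 := by
  have hbd : ∀ (ψ : Y → ℂ), Integrable ψ μ → ∀ g : X →ᵇ ℂ,
      Integrable (fun y => ψ y * g (T y)) μ := by
    intro ψ hψ g
    refine hψ.mul_bdd (c := ‖g‖) ?_ ?_
    · exact (g.continuous.measurable.comp hT).aestronglyMeasurable
    · exact Filter.Eventually.of_forall fun y => g.norm_coe_le_norm _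
  have hFc : Integrable (fun y => (starRingEnd ℂ) (F y)) μ :=
    (Complex.conjLIE.toContinuousLinearEquiv.toContinuousLinearMap.integrable_comp hF)
  -- Star-closedness makes the conjugate density annihilate the family too, which reduces the claim
  -- to real and imaginary parts.
  have hc : ∀ g ∈ M, ∫ y, (starRingEnd ℂ) (F y) * g (T y) ∂μ = 0 := by
    intro g hg
    have := congrArg (starRingEnd ℂ) (h _ (hstar g hg))
    rw [← integral_conj, map_zero] at this
    simpa using this
  have hre : ∫ y in T ⁻¹' B, (F y).re ∂μ = 0 := by
    apply setIntegral_preimage_eq_zero_real hF.re hT M hstar hsep _ hB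
    intro g hg
    have : ∀ y, ((F y).re : ℂ) * g (T y)
        = (1 / 2) * (F y * g (T y) + (starRingEnd ℂ) (F y) * g (T y)) := by
      intro y; rw [Complex.re_eq_add_conj]; ring
    change ∫ y, ((F y).re : ℂ) * g (T y) ∂μ = 0
    simp_rw [this]
    rw [integral_const_mul, integral_add (hbd _ hF g) (hbd _ hFc g), h g hg, hc g hg]
    simp
  have him : ∫ y in T ⁻¹' B, (F y).im ∂μ = 0 := by
    apply setIntegral_preimage_eq_zero_real hF.im hT M hstar hsep _ hB
    intro g hg
    have : ∀ y, ((F y).im : ℂ) * g (T y)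
        = (1 / (2 * Complex.I)) * (F y * g (T y) - (starRingEnd ℂ) (F y) * g (T y)) := by
      intro y; rw [Complex.im_eq_sub_conj]; ring
    change ∫ y, ((F y).im : ℂ) * g (T y) ∂μ = 0
    simp_rw [this]
    rw [integral_const_mul, integral_sub (hbd _ hF g) (hbd _ hFc g), h g hg, hc g hg]
    simp
  have := integral_re_add_im (𝕜 := ℂ) (hF.integrableOn (s := T ⁻¹' B))
  rw [← this]
  simp only [RCLike.re_to_complex, RCLike.im_to_complex, hre, him]
  simp

end Uniqueness

/-! ### Vanishing on hyperplanes and vanishing periodization -/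

section Periodization

variable {E : Type*} [NormedAddCommGroup E] [InnerProductSpace ℝ E]

/-- The coordinate of `ω` along `u`, normalized to be `1` at `u`. -/
noncomputable def coordAlong (u ω : E) : ℝ := inner ℝ ω u / ‖u‖ ^ 2

/-- The map identifying points that differ by an integer multiple of `u`. -/
noncomputable def modShift (u ω : E) : UnitAddCircle × E :=
  ((coordAlong u ω : UnitAddCircle), ω - coordAlong u ω • u)

theorem coordAlong_add_zsmul {u : E} (hu : u ≠ 0) (ω : E) (k : ℤ) :
    coordAlong u (ω + (k : ℝ) • u) = coordAlong u ω + k := by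
  have : ‖u‖ ≠ 0 := norm_ne_zero_iff.2 hu
  rw [coordAlong, coordAlong, inner_add_left, inner_smul_left, real_inner_self_eq_norm_sq]
  simp only [conj_trivial]
  field_simp

theorem continuous_coordAlong (u : E) : Continuous (coordAlong u) := by
  unfold coordAlong; fun_prop

theorem exists_int_of_coe_unitAddCircle_eq {x y : ℝ}
    (h : (x : UnitAddCircle) = (y : UnitAddCircle)) : ∃ k : ℤ, x = y + k := by
  rw [← sub_eq_zero, ← AddCircle.coe_sub, AddCircle.coe_eq_zero_iff] at h
  obtain ⟨n, hn⟩ := h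
  refine ⟨n, ?_⟩
  rw [zsmul_eq_mul, mul_one] at hn
  linarith

theorem coe_add_int_unitAddCircle (x : ℝ) (k : ℤ) :
    ((x + k : ℝ) : UnitAddCircle) = (x : UnitAddCircle) := by
  rw [← sub_eq_zero, ← AddCircle.coe_sub, AddCircle.coe_eq_zero_iff]
  exact ⟨k, by rw [zsmul_eq_mul]; ring⟩

theorem modShift_eq_iff {u : E} (hu : u ≠ 0) {ω ω' : E} :
    modShift u ω = modShift u ω' ↔ ∃ k : ℤ, ω = ω' + (k : ℝ) • u := by
  constructor
  · intro h
    have h1 := congrArg Prod.fst h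
    have h2 := congrArg Prod.snd h
    simp only [modShift] at h1 h2
    obtain ⟨k, hk⟩ := exists_int_of_coe_unitAddCircle_eq h1
    refine ⟨k, ?_⟩
    rw [hk, add_smul] at h2
    have := sub_eq_iff_eq_add.1 h2
    rw [this]; abel
  · rintro ⟨k, rfl⟩
    simp only [modShift, coordAlong_add_zsmul hu, coe_add_int_unitAddCircle]
    rw [add_smul]
    simp

open BoundedContinuousFunction in
/-- The characters of `UnitAddCircle × E`. -/
noncomputable def circleChar (j : ℤ) (v : E) : (UnitAddCircle × E) →ᵇ ℂ :=
  BoundedContinuousFunction.ofNormedAddCommGroup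
    (fun p => fourier j p.1 * Real.fourierChar (inner ℝ p.2 v))
    (((fourier j).continuous.comp continuous_fst).mul
      (continuous_induced_dom.comp (Real.continuous_fourierChar.comp
        (continuous_snd.inner continuous_const)))) 1
    (fun p => by rw [norm_mul, Circle.norm_coe, mul_one, fourier_apply, Circle.norm_coe])

theorem circleChar_apply (j : ℤ) (v : E) (p : UnitAddCircle × E) :
    circleChar j v p = fourier j p.1 * Real.fourierChar (inner ℝ p.2 v) := rfl

open BoundedContinuousFunction in
/-- The submonoid of the characters of `UnitAddCircle × E`. -/
noncomputable def circleCharSubmonoid (E : Type*) [NormedAddCommGroup E]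
    [InnerProductSpace ℝ E] : Submonoid ((UnitAddCircle × E) →ᵇ ℂ) where
  carrier := {g | ∃ (j : ℤ) (v : E), g = circleChar j v}
  one_mem' := ⟨0, 0, by ext p; simp [circleChar_apply]⟩
  mul_mem' := by
    rintro _ _ ⟨j, v, rfl⟩ ⟨k, w, rfl⟩
    refine ⟨j + k, v + w, ?_⟩
    ext p
    simp only [BoundedContinuousFunction.coe_mul, Pi.mul_apply, circleChar_apply,
      inner_add_right, AddChar.map_add_eq_mul, fourier_add, Circle.coe_mul]
    exact mul_mul_mul_comm _ _ _ _

theorem star_mem_circleCharSubmonoid :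
    ∀ g ∈ circleCharSubmonoid E, star g ∈ circleCharSubmonoid E := by
  rintro _ ⟨j, v, rfl⟩
  refine ⟨-j, -v, ?_⟩
  ext p
  simp only [BoundedContinuousFunction.star_apply, circleChar_apply, inner_neg_right,
    fourier_neg, AddChar.map_neg_eq_inv, Circle.coe_inv_eq_conj, star_mul', RCLike.star_def]

theorem circleCharSubmonoid_separates (p q : UnitAddCircle × E) (h : p ≠ q) :
    ∃ g ∈ circleCharSubmonoid E, g p ≠ g q := by
  by_cases h1 : p.1 = q.1
  · have h2 : p.2 - q.2 ≠ 0 := fun h' => h (Prod.ext h1 (sub_eq_zero.1 h'))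
    -- The vector is scaled so that its inner products with `p.2` and `q.2` differ by `1 / 2`, and
    -- the character values by the factor `-1`.
    refine ⟨_, ⟨0, (1 / 2 / ‖p.2 - q.2‖ ^ 2) • (p.2 - q.2), rfl⟩, ?_⟩
    intro h'
    simp only [circleChar_apply, fourier_zero, one_mul] at h'
    have h3 : inner ℝ p.2 ((1 / 2 / ‖p.2 - q.2‖ ^ 2) • (p.2 - q.2)) =
        inner ℝ q.2 ((1 / 2 / ‖p.2 - q.2‖ ^ 2) • (p.2 - q.2)) + 1 / 2 := by
      rw [← sub_eq_iff_eq_add', ← inner_sub_left, inner_smul_right, real_inner_self_eq_norm_sq,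
        div_mul_cancel₀]
      simpa using h2
    rw [h3, AddChar.map_add_eq_mul, Circle.coe_mul] at h'
    have h4 : ((Real.fourierChar (1 / 2 : ℝ) : Circle) : ℂ) = -1 := by
      rw [Real.fourierChar_apply, ← Complex.exp_pi_mul_I]
      congr 1
      push_cast
      ring
    rw [h4, mul_neg_one] at h'
    exact Circle.coe_ne_zero _ (neg_eq_self.1 h')
  · refine ⟨_, ⟨1, 0, rfl⟩, ?_⟩
    intro h'
    simp only [circleChar_apply, fourier_one, inner_zero_right, AddChar.map_zero_eq_one,
      Circle.coe_one, mul_one] at h'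
    exact h1 (AddCircle.injective_toCircle one_ne_zero (Circle.ext h'))

/-- A shift by `k • u` moves the coordinate along `u` by `k`, while this coordinate is bounded on
`K`. Periodizations thus become finite sums, uniformly on slabs. -/
theorem exists_nat_forall_shift_notMem {K : Set E} (hK : Bornology.IsBounded K) {u : E}
    (hu : u ≠ 0) (c : ℝ) :
    ∃ L : ℕ, ∀ ω, |coordAlong u ω| ≤ c → ∀ k : ℤ, (L : ℤ) < |k| → ω + (k : ℝ) • u ∉ K := by
  have hu' : 0 < ‖u‖ := norm_pos_iff.2 hu
  obtain ⟨R, hR⟩ := hK.exists_norm_le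
  obtain ⟨L, hL⟩ := exists_nat_ge (R / ‖u‖ + c)
  refine ⟨L, fun ω hω k hk hmem => ?_⟩
  have h1 : |coordAlong u (ω + (k : ℝ) • u)| ≤ R / ‖u‖ := by
    rw [coordAlong, abs_div, abs_of_pos (pow_pos hu' 2), div_le_div_iff₀ (pow_pos hu' 2) hu']
    calc |inner ℝ (ω + (k : ℝ) • u) u| * ‖u‖ ≤ (‖ω + (k : ℝ) • u‖ * ‖u‖) * ‖u‖ :=
          mul_le_mul_of_nonneg_right (abs_real_inner_le_norm _ _) hu'.le
      _ ≤ (R * ‖u‖) * ‖u‖ := by gcongr; exact hR _ hmem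
      _ = R * ‖u‖ ^ 2 := by ring
  rw [coordAlong_add_zsmul hu] at h1
  have h2 : (L : ℝ) < |(k : ℝ)| := by exact_mod_cast hk
  have h3 := abs_sub_abs_le_abs_sub (k : ℝ) (-coordAlong u ω)
  rw [abs_neg, sub_neg_eq_add, add_comm (k : ℝ)] at h3
  linarith

variable [FiniteDimensional ℝ E] [MeasurableSpace E] [BorelSpace E]

/-- If the inverse Fourier transform of `F` vanishes where `⟪r, u⟫` is an integer, then the
periodization of `F` along `u` vanishes. -/
theorem tsum_shift_eq_zero {F : E → ℂ} (hF : Integrable F) {K : Set E}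
    (hK : Bornology.IsBounded K) (hFK : ∀ ξ, ξ ∉ K → F ξ = 0) {u : E} (hu : u ≠ 0)
    (h0 : ∀ r : E, (∃ j : ℤ, inner ℝ r u = (j : ℝ)) → 𝓕⁻ F r = 0) :
    ∀ᵐ ω : E, ∑' k : ℤ, F (ω + (k : ℝ) • u) = 0 := by
  have hu' : ‖u‖ ≠ 0 := norm_ne_zero_iff.2 hu
  have hTm : Measurable (modShift u) := by
    apply Measurable.prodMk
    · exact ((AddCircle.continuous_mk' 1).comp (continuous_coordAlong u)).measurable
    · exact (continuous_id.sub ((continuous_coordAlong u).smul continuous_const)).measurable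
  have hchar : ∀ g ∈ circleCharSubmonoid E, ∫ ω, F ω * g (modShift u ω) = 0 := by
    rintro _ ⟨j, v, rfl⟩
    -- The multiple of `u` is chosen so that the inner product of this point with `u` is `j`; its
    -- exponential is then the pullback of the character `(j, v)` under `modShift u`.
    rw [← h0 (v + ((j - inner ℝ u v) / ‖u‖ ^ 2) • u) ⟨j, ?_⟩, Real.fourierInv_eq]
    · refine integral_congr_ae (Filter.Eventually.of_forall fun ω => ?_)
      simp only [circleChar_apply, modShift, Circle.smul_def, smul_eq_mul]
      rw [mul_comm, fourier_coe_apply, Real.fourierChar_apply, Real.fourierChar_apply,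
        ← Complex.exp_add]
      congr 2
      simp only [coordAlong, inner_add_right, inner_smul_right, inner_sub_left, inner_smul_left,
        conj_trivial]
      push_cast
      ring
    · rw [inner_add_left, inner_smul_left, real_inner_self_eq_norm_sq, conj_trivial,
        div_mul_cancel₀ _ (pow_ne_zero 2 hu'), real_inner_comm]
      ring
  have hB : ∀ B : Set (UnitAddCircle × E), MeasurableSet B → ∫ ω in modShift u ⁻¹' B, F ω = 0 :=
    fun B hB => setIntegral_preimage_eq_zero hF hTm _ star_mem_circleCharSubmonoid
      circleCharSubmonoid_separates hchar hB
  let S : E → ℂ := fun ω => ∑' k : ℤ, F (ω + (k : ℝ) • u)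
  -- Each slab `D m` is a fundamental domain for translation by `u`.
  let D : ℤ → Set E := fun m => {ω | (m : ℝ) ≤ coordAlong u ω ∧ coordAlong u ω < m + 1}
  have hDm : ∀ m, MeasurableSet (D m) := fun m =>
    (measurableSet_le measurable_const (continuous_coordAlong u).measurable).inter
      (measurableSet_lt (continuous_coordAlong u).measurable measurable_const)
  have hDk : ∀ m : ℤ, ∀ ω ∈ D m, ∀ k : ℤ, ω + (k : ℝ) • u ∈ D m → k = 0 := by
    rintro m ω ⟨h1, h2⟩ k ⟨h3, h4⟩
    rw [coordAlong_add_zsmul hu] at h3 h4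
    have a : (k : ℝ) < 1 := by linarith
    have b : (-1 : ℝ) < k := by linarith
    have a' : k < 1 := by exact_mod_cast a
    have b' : -1 < k := by exact_mod_cast b
    omega
  have hinj : ∀ m, Set.InjOn (modShift u) (D m) := by
    intro m ω hω ω' hω' h
    obtain ⟨k, rfl⟩ := (modShift_eq_iff hu).1 h
    rw [hDk m ω' hω' k hω]; simp
  have hpre : ∀ A : Set E, modShift u ⁻¹' (modShift u '' A)
      = ⋃ k : ℤ, (fun ω => ω + ((-k : ℤ) : ℝ) • u) ⁻¹' A := by
    intro A
    ext ω
    simp only [Set.mem_preimage, Set.mem_image, Set.mem_iUnion]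
    constructor
    · rintro ⟨a, ha, hω⟩
      obtain ⟨k, rfl⟩ := (modShift_eq_iff hu).1 hω
      refine ⟨-k, by simpa using ha⟩
    · rintro ⟨k, hk⟩
      exact ⟨_, hk, (modShift_eq_iff hu).2 ⟨-k, rfl⟩⟩
  have htr : ∀ (k : ℤ) (A : Set E) {V : Type} [NormedAddCommGroup V] [NormedSpace ℝ V] (G : E → V),
      ∫ ω in (fun ω => ω + ((-k : ℤ) : ℝ) • u) ⁻¹' A, G ω = ∫ ω in A, G (ω + (k : ℝ) • u) := by
    intro k A V _ _ G
    have := (measurePreserving_add_right volume (((-k : ℤ) : ℝ) • u)).setIntegral_preimage_emb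
      (MeasurableEquiv.addRight (((-k : ℤ) : ℝ) • u)).measurableEmbedding
      (fun ω => G (ω + (k : ℝ) • u)) A
    rw [← this]
    simp
  have hD0 : ∀ m : ℤ, ∀ᵐ ω ∂(volume.restrict (D m)), S ω = 0 := by
    intro m
    have hmA : ∀ A, MeasurableSet A → ∀ k : ℤ,
        MeasurableSet ((fun ω : E => ω + ((-k : ℤ) : ℝ) • u) ⁻¹' A) := fun A hA k =>
      measurable_add_const _ hA
    have hdisj : ∀ A ⊆ D m, Pairwise (Function.onFun Disjoint
        fun k : ℤ => (fun ω : E => ω + ((-k : ℤ) : ℝ) • u) ⁻¹' A) := by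
      intro A hA k l hkl
      refine Set.disjoint_left.2 fun ω h1 h2 => hkl ?_
      have := hDk m _ (hA h1) (k - l) (by
        have := hA h2
        convert this using 1
        push_cast
        module)
      omega
    have hFi : ∀ k : ℤ, Integrable fun ω => F (ω + (k : ℝ) • u) := fun k =>
      hF.comp_add_right _
    have hsum : Summable fun k : ℤ => ∫ ω in D m, ‖F (ω + (k : ℝ) • u)‖ := by
      have := (hasSum_integral_iUnion (hmA _ (hDm m)) (hdisj _ subset_rfl)
        (f := fun ω => ‖F ω‖) hF.norm.integrableOn).summable
      simpa only [htr] using this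
    -- The saturation of `A` under translations is a disjoint union of translates, so the integral
    -- of `F` over it is that of `S` over `A`. It is the preimage of the image of `A`, which is
    -- measurable because `modShift u` is injective on the slab.
    have key : ∀ A, MeasurableSet A → A ⊆ D m → ∫ ω in A, S ω = 0 := by
      intro A hA hAD
      have h1 := hasSum_integral_iUnion (hmA A hA) (hdisj A hAD) hF.integrableOn
      rw [← hpre, hB _ (hA.image_of_measurable_injOn hTm ((hinj m).mono hAD))] at h1
      simp only [htr] at h1
      have h2 := hasSum_integral_of_summable_integral_norm (μ := volume.restrict A)
        (F := fun (k : ℤ) ω => F (ω + (k : ℝ) • u)) (fun k => (hFi k).integrableOn)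
        (Summable.of_nonneg_of_le (fun k => integral_nonneg fun _ => norm_nonneg _)
          (fun k => setIntegral_mono_set (hFi k).norm.integrableOn
            (Filter.Eventually.of_forall fun _ => norm_nonneg _)
            (Filter.Eventually.of_forall hAD)) hsum)
      exact h2.unique h1
    have hSi : IntegrableOn S (D m) := by
      obtain ⟨L, hL⟩ := exists_nat_forall_shift_notMem hK hu (|(m : ℝ)| + 1)
      have hS : Set.EqOn (fun ω => ∑ k ∈ Finset.Icc (-(L : ℤ)) L, F (ω + (k : ℝ) • u)) S
          (D m) := by
        intro ω hω
        refine (tsum_eq_sum fun k hk => hFK _ (hL ω ?_ k ?_)).symm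
        · obtain ⟨h1, h2⟩ := hω
          rw [abs_le]
          constructor
          · linarith [neg_abs_le (m : ℝ)]
          · linarith [le_abs_self (m : ℝ)]
        · by_contra hc
          exact hk (Finset.mem_Icc.2 (abs_le.1 (not_lt.1 hc)))
      exact (integrable_finsetSum _ fun k _ => hFi k).integrableOn.congr_fun hS (hDm m)
    exact hSi.ae_eq_zero_of_forall_setIntegral_eq_zero fun A hA _ => by
      rw [Measure.restrict_restrict hA]
      exact key _ (hA.inter (hDm m)) Set.inter_subset_right
  have hall : ∀ᵐ ω : E, ∀ m : ℤ, ω ∈ D m → S ω = 0 :=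
    ae_all_iff.2 fun m => (ae_restrict_iff' (hDm m)).1 (hD0 m)
  filter_upwards [hall] with ω hω
  exact hω ⌊coordAlong u ω⌋ ⟨Int.floor_le _, Int.lt_floor_add_one _⟩

end Periodization

/-! ### Operations on functions with given spectrum -/

section SpectrumCalculus

variable {E : Type*} [NormedAddCommGroup E] [InnerProductSpace ℝ E] [FiniteDimensional ℝ E]
  [MeasurableSpace E] [BorelSpace E]

theorem HasSpectrumIn.mono {K L : Set E} {f : E → ℂ} (hf : HasSpectrumIn K f) (h : K ⊆ L) :
    HasSpectrumIn L f := by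
  obtain ⟨F, h1, h2, h0, rfl⟩ := hf
  exact ⟨F, h1, h2, fun ξ hξ => h0 ξ fun hk => hξ (h hk), rfl⟩

theorem HasSpectrumIn.continuous {K : Set E} {f : E → ℂ} (hf : HasSpectrumIn K f) :
    Continuous f := by
  obtain ⟨F, h1, -, -, rfl⟩ := hf
  exact continuous_fourierInv h1

theorem integrable_fourierChar_mul {F : E → ℂ} (hF : Integrable F) (r : E) :
    Integrable fun ξ => (Real.fourierChar (inner ℝ ξ r) : ℂ) * F ξ := by
  refine hF.bdd_mul (c := 1) ?_ ?_
  · exact (continuous_induced_dom.comp (Real.continuous_fourierChar.comp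
      (continuous_id.inner continuous_const))).aestronglyMeasurable
  · exact Filter.Eventually.of_forall fun _ => (Circle.norm_coe _).le

theorem memLp_fourierChar_mul {F : E → ℂ} (hF : MemLp F 2 volume) (r : E) :
    MemLp (fun ξ => (Real.fourierChar (inner ℝ ξ r) : ℂ) * F ξ) 2 volume := by
  refine hF.of_le ?_ ?_
  · exact (continuous_induced_dom.comp (Real.continuous_fourierChar.comp
      (continuous_id.inner continuous_const))).aestronglyMeasurable.mul hF.1
  · exact Filter.Eventually.of_forall fun _ => by rw [norm_mul, Circle.norm_coe, one_mul]

theorem fourierInv_apply (F : E → ℂ) (r : E) :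
    (𝓕⁻ F : E → ℂ) r = ∫ ξ, (Real.fourierChar (inner ℝ ξ r) : ℂ) * F ξ := by
  rw [Real.fourierInv_eq]; rfl

theorem fourierInv_sub {F G : E → ℂ} (hF : Integrable F) (hG : Integrable G) (r : E) :
    (𝓕⁻ (fun ξ => F ξ - G ξ) : E → ℂ) r = 𝓕⁻ F r - 𝓕⁻ G r := by
  simp only [fourierInv_apply, mul_sub]
  exact integral_sub (integrable_fourierChar_mul hF r) (integrable_fourierChar_mul hG r)

theorem fourierInv_const_mul (c : ℂ) (F : E → ℂ) (r : E) :
    (𝓕⁻ (fun ξ => c * F ξ) : E → ℂ) r = c * 𝓕⁻ F r := by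
  simp only [fourierInv_apply, mul_left_comm _ c]
  exact integral_const_mul _ _

theorem fourierInv_modulate (F : E → ℂ) (w r : E) :
    (𝓕⁻ (fun ξ => (Real.fourierChar (inner ℝ ξ w) : ℂ) * F ξ) : E → ℂ) r = 𝓕⁻ F (r + w) := by
  simp only [fourierInv_apply, inner_add_right, AddChar.map_add_eq_mul, Circle.coe_mul, mul_assoc]

theorem fourierInv_shift (F : E → ℂ) (u r : E) :
    (𝓕⁻ (fun ξ => F (ξ + u)) : E → ℂ) r = Real.fourierChar (-inner ℝ u r) * 𝓕⁻ F r := by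
  simp only [fourierInv_apply]
  rw [← integral_const_mul,
    ← integral_add_right_eq_self (fun ξ => (Real.fourierChar (-inner ℝ u r) : ℂ) * _) u]
  refine integral_congr_ae (Filter.Eventually.of_forall fun ξ => ?_)
  simp only
  rw [← mul_assoc, ← Circle.coe_mul, ← AddChar.map_add_eq_mul, inner_add_left]
  congr 4
  ring

theorem HasSpectrumIn.sub {K : Set E} {f g : E → ℂ} (hf : HasSpectrumIn K f)
    (hg : HasSpectrumIn K g) : HasSpectrumIn K fun r => f r - g r := by
  obtain ⟨F, h1, h2, h0, rfl⟩ := hf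
  obtain ⟨G, k1, k2, k0, rfl⟩ := hg
  refine ⟨fun ξ => F ξ - G ξ, h1.sub k1, h2.sub k2, fun ξ hξ => ?_, ?_⟩
  · simp only [h0 ξ hξ, k0 ξ hξ, sub_zero]
  · ext r; exact (fourierInv_sub h1 k1 r).symm

theorem HasSpectrumIn.const_mul {K : Set E} {f : E → ℂ} (hf : HasSpectrumIn K f) (c : ℂ) :
    HasSpectrumIn K fun r => c * f r := by
  obtain ⟨F, h1, h2, h0, rfl⟩ := hf
  refine ⟨fun ξ => c * F ξ, h1.const_mul c, h2.const_mul c, fun ξ hξ => ?_, ?_⟩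
  · simp only [h0 ξ hξ, mul_zero]
  · ext r; exact (fourierInv_const_mul c F r).symm

theorem HasSpectrumIn.translate {K : Set E} {f : E → ℂ} (hf : HasSpectrumIn K f) (w : E) :
    HasSpectrumIn K fun r => f (r + w) := by
  obtain ⟨F, h1, h2, h0, rfl⟩ := hf
  refine ⟨fun ξ => (Real.fourierChar (inner ℝ ξ w) : ℂ) * F ξ, integrable_fourierChar_mul h1 w,
    memLp_fourierChar_mul h2 w, fun ξ hξ => ?_, ?_⟩
  · simp only [h0 ξ hξ, mul_zero]
  · ext r; exact (fourierInv_modulate F w r).symm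

theorem HasSpectrumIn.modulate {K : Set E} {f : E → ℂ} (hf : HasSpectrumIn K f) (u : E) :
    HasSpectrumIn {ξ | ξ + u ∈ K} fun r => (Real.fourierChar (-inner ℝ u r) : ℂ) * f r := by
  obtain ⟨F, h1, h2, h0, rfl⟩ := hf
  refine ⟨fun ξ => F (ξ + u), h1.comp_add_right u,
    h2.comp_measurePreserving (measurePreserving_add_right volume u), fun ξ hξ => h0 _ hξ, ?_⟩
  ext r; exact (fourierInv_shift F u r).symm

end SpectrumCalculus

/-! ### Division by the factor of a hyperplane family -/

section Division

variable {E : Type*} [NormedAddCommGroup E] [InnerProductSpace ℝ E]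

theorem mem_of_shift_mem {K : Set E} (hK : Convex ℝ K) {ω u : E} {a b t : ℝ}
    (ha : ω + a • u ∈ K) (hb : ω + b • u ∈ K) (hat : a ≤ t) (htb : t ≤ b) : ω + t • u ∈ K := by
  have h : Convex ℝ ((fun s : ℝ => ω + s • u) ⁻¹' K) := by
    intro s hs s' hs' α β hα hβ hαβ
    have := hK hs hs' hα hβ hαβ
    simp only [Set.mem_preimage, smul_eq_mul] at this ⊢
    convert this using 1
    rw [show α = 1 - β by linarith]
    module
  exact h.ordConnected.out ha hb ⟨hat, htb⟩

/-- If the sum of `F` over the whole line `ω + ℤ u` vanishes and `F` vanishes off a convex set `K`,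
then the sum over the half line vanishes unless `ω` and `ω - u` belong to `K`. -/
theorem tsum_half_eq_zero {F : E → ℂ} {K : Set E} (hK : Convex ℝ K)
    (hFK : ∀ ξ, ξ ∉ K → F ξ = 0) {u ω : E} (hs : Summable fun k : ℤ => F (ω + (k : ℝ) • u))
    (h0 : ∑' k : ℤ, F (ω + (k : ℝ) • u) = 0) (hω : ¬ (ω ∈ K ∧ ω - u ∈ K)) :
    ∑' k : ℕ, F (ω + (k : ℝ) • u) = 0 := by
  by_contra hne
  have hinj : Function.Injective fun k : ℕ => -((k : ℤ) + 1) :=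
    neg_injective.comp ((add_left_injective (1 : ℤ)).comp Nat.cast_injective)
  have hs1 := hs.comp_injective (Nat.cast_injective (R := ℤ))
  have hs2 := hs.comp_injective hinj
  simp only [Function.comp_def] at hs1 hs2
  have hsplit := tsum_of_nat_of_neg_add_one (f := fun k : ℤ => F (ω + (k : ℝ) • u)) hs1 hs2
  rw [h0] at hsplit
  simp only [Int.cast_natCast] at hsplit
  -- A nonzero half sum forces the complementary half to be nonzero. So `K` meets the line at some
  -- index `≥ 0` and at some index `≤ -1`, and by convexity at `0` and `-1`.
  obtain ⟨k, hk⟩ : ∃ k : ℕ, ω + (k : ℝ) • u ∈ K := by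
    by_contra! hc
    exact hne (by rw [tsum_congr fun k : ℕ => hFK _ (hc k), tsum_zero])
  obtain ⟨l, hl⟩ : ∃ l : ℕ, ω + ((-((l : ℤ) + 1) : ℤ) : ℝ) • u ∈ K := by
    by_contra! hc
    rw [tsum_congr fun k : ℕ => hFK _ (hc k), tsum_zero, add_zero] at hsplit
    exact hne hsplit.symm
  push_cast at hl
  have hk0 : (0 : ℝ) ≤ k := Nat.cast_nonneg k
  have hl0 : (0 : ℝ) ≤ l := Nat.cast_nonneg l
  refine hω ⟨?_, ?_⟩
  · simpa using mem_of_shift_mem hK hl hk (t := 0) (by linarith) hk0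
  · have := mem_of_shift_mem hK hl hk (t := -1) (by linarith) (by linarith)
    simpa [sub_eq_add_neg] using this

theorem finite_shift_mem {K : Set E} (hK : Bornology.IsBounded K) {u : E} (hu : u ≠ 0) (ω : E) :
    {k : ℤ | ω + (k : ℝ) • u ∈ K}.Finite := by
  obtain ⟨L, hL⟩ := exists_nat_forall_shift_notMem hK hu |coordAlong u ω|
  refine (Set.finite_Icc (-(L : ℤ)) L).subset fun k hk => ?_
  by_contra hc
  exact hL ω le_rfl k (lt_of_not_ge fun h => hc (abs_le.1 h)) hk

variable [FiniteDimensional ℝ E] [MeasurableSpace E] [BorelSpace E]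

/-- A function with spectrum in a convex set that vanishes where `⟪r - w, u⟫` is an integer is
divisible by `1 - exp (-2πi⟪u, r - w⟫)`. -/
theorem HasSpectrumIn.exists_quotient {K : Set E} (hKc : Convex ℝ K)
    (hKb : Bornology.IsBounded K) (hKm : MeasurableSet K) {f : E → ℂ} (hf : HasSpectrumIn K f)
    {u : E} (hu : u ≠ 0) (w : E)
    (h0 : ∀ r : E, (∃ j : ℤ, inner ℝ (r - w) u = (j : ℝ)) → f r = 0) :
    ∃ g, HasSpectrumIn {ξ | ξ ∈ K ∧ ξ - u ∈ K} g ∧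
      ∀ r, f r = g r * (1 - Real.fourierChar (-inner ℝ u (r - w))) := by
  obtain ⟨F, hF1, hF2, hFK, hfF⟩ := hf.translate w
  have hF : ∀ᵐ ω : E, ∑' k : ℤ, F (ω + (k : ℝ) • u) = 0 := by
    apply tsum_shift_eq_zero hF1 hKb hFK hu
    rintro r ⟨j, hj⟩
    rw [← hfF]
    exact h0 _ ⟨j, by rwa [add_sub_cancel_right]⟩
  set K' : Set E := {ξ | ξ ∈ K ∧ ξ - u ∈ K} with hK'
  have hK'm : MeasurableSet K' := hKm.inter (measurable_sub_const u hKm)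
  obtain ⟨L, hL⟩ : ∃ L : ℕ, ∀ ω ∈ K, ∀ k : ℕ, L ≤ k → ω + (k : ℝ) • u ∉ K := by
    obtain ⟨R, hR⟩ := (hKb.isCompact_closure.image (continuous_coordAlong u)).isBounded.exists_norm_le
    obtain ⟨L, hL⟩ := exists_nat_forall_shift_notMem hKb hu R
    refine ⟨L + 1, fun ω hω k hk => ?_⟩
    have := hL ω (hR _ ⟨ω, subset_closure hω, rfl⟩) k (by rw [Nat.abs_cast]; exact_mod_cast hk)
    exact_mod_cast this
  -- The half-line sum of `F`. The cutoff changes it only on a null set (`hGS`), and on `K'` terms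
  -- with index at least `L` vanish.
  let G : E → ℂ := K'.indicator fun ω => ∑ k ∈ Finset.range L, F (ω + (k : ℝ) • u)
  have hG1 : Integrable G :=
    (integrable_finsetSum _ fun k _ => hF1.comp_add_right _).indicator hK'm
  have hG2 : MemLp G 2 volume :=
    (memLp_finsetSum (Finset.range L) (f := fun (k : ℕ) ω => F (ω + (k : ℝ) • u)) fun k _ =>
      hF2.comp_measurePreserving (measurePreserving_add_right volume ((k : ℝ) • u))).indicator hK'm
  have hGK : ∀ ξ, ξ ∉ K' → G ξ = 0 := fun ξ h => Set.indicator_of_notMem h _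
  have hsum : ∀ ω, Summable fun k : ℤ => F (ω + (k : ℝ) • u) := fun ω =>
    summable_of_hasFiniteSupport ((finite_shift_mem hKb hu ω).subset fun k hk => by
      by_contra hc
      exact hk (hFK _ hc))
  have hsumN : ∀ ω, Summable fun k : ℕ => F (ω + (k : ℝ) • u) := fun ω => by
    simpa using! (hsum ω).comp_injective (Nat.cast_injective (R := ℤ))
  have hGS : ∀ᵐ ω : E, G ω = ∑' k : ℕ, F (ω + (k : ℝ) • u) := by
    filter_upwards [hF] with ω hω
    by_cases h : ω ∈ K'
    · simp only [G, Set.indicator_of_mem h]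
      refine (tsum_eq_sum fun k hk => hFK _ (hL ω h.1 k ?_)).symm
      simpa using hk
    · rw [hGK ω h, tsum_half_eq_zero hKc hFK (hsum ω) hω h]
  have hGS' : ∀ᵐ ω : E, G (ω + u) = ∑' k : ℕ, F (ω + u + (k : ℝ) • u) :=
    (measurePreserving_add_right volume u).quasiMeasurePreserving.ae hGS
  -- Telescoping: the half sums at `ω` and `ω + u` differ by the term of index `0`.
  have hFG : F =ᵐ[volume] fun ω => G ω - G (ω + u) := by
    filter_upwards [hGS, hGS'] with ω h1 h2
    rw [h1, h2, (hsumN ω).tsum_eq_zero_add]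
    have : ∀ k : ℕ, ω + ((k + 1 : ℕ) : ℝ) • u = ω + u + (k : ℝ) • u := fun k => by
      push_cast; module
    simp only [this]
    simp
  refine ⟨fun r => 𝓕⁻ G (r + -w), HasSpectrumIn.translate ⟨G, hG1, hG2, hGK, rfl⟩ (-w), fun r => ?_⟩
  have h1 := congrFun hfF (r - w)
  simp only [sub_add_cancel] at h1
  rw [h1, Real.fourierInv_congr_ae hFG, fourierInv_sub hG1 (hG1.comp_add_right u),
    fourierInv_shift]
  simp only [← sub_eq_add_neg]
  ring

end Division

/-! ### Several families: iterated quotients and products -/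

section Families

variable {E : Type*} [NormedAddCommGroup E] [InnerProductSpace ℝ E]

/-- The union of the hyperplanes `⟪r - w, u⟫ = j`, `j ∈ ℤ`. -/
def hyperplaneFamily (u w : E) : Set E := {r | ∃ j : ℤ, inner ℝ (r - w) u = (j : ℝ)}

theorem exists_int_of_fourierChar_eq_one {x : ℝ} (h : (Real.fourierChar x : ℂ) = 1) :
    ∃ k : ℤ, x = k := by
  rw [Real.fourierChar_apply] at h
  obtain ⟨n, hn⟩ := Complex.exp_eq_one_iff.1 h
  refine ⟨n, ?_⟩
  have hpi : (Real.pi : ℂ) ≠ 0 := by exact_mod_cast Real.pi_ne_zero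
  have h2 : (2 * Real.pi * Complex.I : ℂ) ≠ 0 := by simp [hpi]
  have : (x : ℂ) = n := by
    apply mul_left_cancel₀ h2
    push_cast at hn
    linear_combination hn
  exact_mod_cast this

theorem fourierChar_int (k : ℤ) : (Real.fourierChar (k : ℝ) : ℂ) = 1 := by
  rw [Real.fourierChar_apply, Complex.exp_eq_one_iff]
  exact ⟨k, by push_cast; ring⟩

theorem one_sub_fourierChar_eq_zero_iff {u w r : E} :
    1 - (Real.fourierChar (-inner ℝ u (r - w)) : ℂ) = 0 ↔ r ∈ hyperplaneFamily u w := by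
  constructor
  · intro h
    obtain ⟨k, hk⟩ := exists_int_of_fourierChar_eq_one (sub_eq_zero.1 h).symm
    refine ⟨-k, ?_⟩
    rw [real_inner_comm]
    push_cast
    linarith
  · rintro ⟨k, hk⟩
    rw [sub_eq_zero, real_inner_comm, hk]
    have := fourierChar_int (-k)
    push_cast at this
    exact this.symm

/-- A line transverse to the hyperplanes meets them in countably many points, so continuity fills in
the missing values. -/
theorem eq_zero_of_vanish_off_hyperplaneFamily {g : E → ℂ} (hg : Continuous g) {u w v x : E}
    (hv : inner ℝ v u ≠ 0)
    (h : ∀ t : ℝ, x + t • v ∉ hyperplaneFamily u w → g (x + t • v) = 0) : g x = 0 := by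
  have hc : {t : ℝ | x + t • v ∈ hyperplaneFamily u w}.Countable := by
    refine (Set.countable_range fun j : ℤ => ((j : ℝ) - inner ℝ (x - w) u) / inner ℝ v u).mono ?_
    rintro t ⟨j, hj⟩
    refine ⟨j, ?_⟩
    simp only
    rw [← hj, div_eq_iff hv, add_sub_right_comm, inner_add_left, inner_smul_left]
    simp
  have hφ : Continuous fun t : ℝ => g (x + t • v) := by fun_prop
  have := hφ.ext_on (hc.dense_compl ℝ) continuous_const (g := fun _ => 0) fun t ht => h t ht
  simpa using congrFun this 0

/-- Take the component of `u i` orthogonal to `u j`; were it orthogonal to `u i` as well, it would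
be zero, making the two vectors dependent. It is a direction inside the hyperplanes of family `j`
that crosses those of family `i`. -/
theorem exists_inner_eq_zero_and_ne_zero {ι : Type*} {u : ι → E} (hu : LinearIndependent ℝ u)
    {i j : ι} (hij : i ≠ j) : ∃ v : E, inner ℝ v (u j) = 0 ∧ inner ℝ v (u i) ≠ 0 := by
  have hj : ‖u j‖ ^ 2 ≠ 0 := pow_ne_zero 2 (norm_ne_zero_iff.2 (hu.ne_zero j))
  set c := inner ℝ (u i) (u j) / ‖u j‖ ^ 2 with hc
  set v := u i - c • u j with hv
  have h1 : inner ℝ v (u j) = 0 := by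
    rw [hv, inner_sub_left, inner_smul_left, real_inner_self_eq_norm_sq, conj_trivial, hc,
      div_mul_cancel₀ _ hj, sub_self]
  refine ⟨v, h1, fun h2 => ?_⟩
  have h3 : inner ℝ v v = 0 := by
    nth_rewrite 2 [hv]
    rw [inner_sub_right, inner_smul_right, h1, h2]
    simp
  have h4 : u i - c • u j = 0 := inner_self_eq_zero.1 h3
  have hpair : LinearIndependent ℝ ![u i, u j] := by
    have := hu.comp ![i, j] (by
      intro a b h
      fin_cases a <;> fin_cases b <;> simp_all [eq_comm])
    have e : u ∘ ![i, j] = ![u i, u j] := by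
      funext k; fin_cases k <;> rfl
    rwa [e] at this
  have h5 := (LinearIndependent.pair_iff.1 hpair) 1 (-c) (by
    rw [one_smul, neg_smul, ← sub_eq_add_neg]; exact h4)
  exact one_ne_zero h5.1

theorem mul_prod_ne_zero {ι : Type*} [DecidableEq ι] {u w : ι → E} (hu : ∀ i, u i ≠ 0) {g : E → ℂ}
    (hg : Continuous g) (hne : g ≠ 0) (s : Finset ι) :
    (fun r => g r * ∏ i ∈ s, (1 - (Real.fourierChar (-inner ℝ (u i) (r - w i)) : ℂ))) ≠ 0 := by
  induction s using Finset.induction_on with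
  | empty => simpa using hne
  | insert a s ha ih =>
    refine fun h => ih ?_
    ext r
    have hc : Continuous fun r =>
        g r * ∏ i ∈ s, (1 - (Real.fourierChar (-inner ℝ (u i) (r - w i)) : ℂ)) := by
      refine hg.mul (continuous_finsetProd _ fun i _ => continuous_const.sub ?_)
      exact continuous_induced_dom.comp (Real.continuous_fourierChar.comp
        (continuous_const.inner (continuous_id.sub continuous_const)).neg)
    refine eq_zero_of_vanish_off_hyperplaneFamily (w := w a) (u := u a) (v := u a) hc
      (inner_self_eq_zero.not.2 (hu a)) fun t ht => ?_
    have := congrFun h (r + t • u a)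
    simp only [Finset.prod_insert ha, Pi.zero_apply] at this
    rw [mul_left_comm] at this
    exact (mul_eq_zero.1 this).resolve_left fun h' => ht (one_sub_fourierChar_eq_zero_iff.1 h')

variable [FiniteDimensional ℝ E] [MeasurableSpace E] [BorelSpace E]

/-- Dividing by the factor of family `a` replaces `K` by `K ∩ (K + u a)`, again compact and convex.
The quotient vanishes on each remaining family: move inside its hyperplane across family `a` and use
continuity. Once all families are used up, the remaining spectral set is nonempty because the
function is nonzero. -/
theorem exists_forall_sub_sum_mem {ι : Type*} [DecidableEq ι] {u : ι → E} (w : ι → E)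
    (hu : LinearIndependent ℝ u) (s : Finset ι) {K : Set E} (hKc : Convex ℝ K) (hK : IsCompact K)
    {f : E → ℂ} (hf : HasSpectrumIn K f)
    (h0 : ∀ i ∈ s, ∀ r ∈ hyperplaneFamily (u i) (w i), f r = 0) (hne : f ≠ 0) :
    ∃ x : E, ∀ T ⊆ s, x - ∑ i ∈ T, u i ∈ K := by
  induction s using Finset.induction_on generalizing K f with
  | empty =>
    by_contra! hc
    apply hne
    obtain ⟨F, -, -, hFK, rfl⟩ := hf
    have hF : F = fun _ => 0 := by
      ext ξ
      refine hFK ξ fun hξ => ?_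
      obtain ⟨T, hT, h⟩ := hc ξ
      rw [Finset.subset_empty.1 hT] at h
      simp [hξ] at h
    ext r
    rw [hF, fourierInv_apply]
    simp
  | insert a s ha ih =>
    obtain ⟨g, hg, hfg⟩ := hf.exists_quotient hKc hK.isBounded hK.measurableSet (hu.ne_zero a) (w a)
      (h0 a (Finset.mem_insert_self a s))
    have hK' : {ξ | ξ ∈ K ∧ ξ - u a ∈ K} = K ∩ (fun ξ => ξ + (-u a)) ⁻¹' K := by
      ext ξ; simp [sub_eq_add_neg]
    rw [hK'] at hg
    obtain ⟨x, hx⟩ := ih (hKc.inter (hKc.translate_preimage_left (-u a)))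
      (hK.inter ((Homeomorph.addRight (-u a)).isCompact_preimage.2 hK)) hg
      (fun i hi r hr => by
        have hia : a ≠ i := fun h => ha (h ▸ hi)
        obtain ⟨v, hv0, hv⟩ := exists_inner_eq_zero_and_ne_zero hu hia
        refine eq_zero_of_vanish_off_hyperplaneFamily (w := w a) hg.continuous hv fun t ht => ?_
        have hmem : r + t • v ∈ hyperplaneFamily (u i) (w i) := by
          obtain ⟨j, hj⟩ := hr
          refine ⟨j, ?_⟩
          rw [add_sub_right_comm, inner_add_left, inner_smul_left, hv0, mul_zero, add_zero, hj]
        have := hfg (r + t • v)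
        rw [h0 i (Finset.mem_insert_of_mem hi) _ hmem] at this
        exact (mul_eq_zero.1 this.symm).resolve_right fun h =>
          ht (one_sub_fourierChar_eq_zero_iff.1 h))
      (fun h => hne (by ext r; rw [hfg, h]; simp))
    refine ⟨x, fun T hT => ?_⟩
    by_cases haT : a ∈ T
    · have := (hx (T.erase a) (Finset.subset_insert_iff.1 hT)).2
      rw [← Finset.add_sum_erase T u haT]
      simpa [sub_eq_add_neg, add_assoc, add_comm, add_left_comm] using this
    · exact (hx T ((Finset.subset_insert_iff_of_notMem haT).1 hT)).1

/-- Each factor subtracts a modulated copy, whose spectrum is translated by `-u i`. -/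
theorem HasSpectrumIn.mul_prod {ι : Type*} [DecidableEq ι] (u w : ι → E) {K : Set E} {g : E → ℂ}
    (hg : HasSpectrumIn K g) (s : Finset ι) :
    HasSpectrumIn {ξ | ∃ T ⊆ s, ξ + ∑ i ∈ T, u i ∈ K}
      fun r => g r * ∏ i ∈ s, (1 - (Real.fourierChar (-inner ℝ (u i) (r - w i)) : ℂ)) := by
  induction s using Finset.induction_on with
  | empty =>
    simp only [Finset.prod_empty, mul_one]
    exact hg.mono fun ξ hξ => ⟨∅, subset_rfl, by simpa using hξ⟩
  | insert a s ha ih =>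
    have h1 := ih.mono (L := {ξ | ∃ T ⊆ insert a s, ξ + ∑ i ∈ T, u i ∈ K})
      fun ξ ⟨T, hT, h⟩ => ⟨T, hT.trans (Finset.subset_insert a s), h⟩
    have h2 := ((ih.modulate (u a)).const_mul (Real.fourierChar (inner ℝ (u a) (w a)))).mono
      (L := {ξ | ∃ T ⊆ insert a s, ξ + ∑ i ∈ T, u i ∈ K}) (by
        rintro ξ ⟨T, hT, h⟩
        refine ⟨insert a T, Finset.insert_subset_insert a hT, ?_⟩
        rwa [Finset.sum_insert fun h' => ha (hT h'), ← add_assoc])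
    convert h1.sub h2 using 1
    ext r
    rw [Finset.prod_insert ha, inner_sub_right,
      show -(inner ℝ (u a) r - inner ℝ (u a) (w a)) = inner ℝ (u a) (w a) + -inner ℝ (u a) r by ring,
      AddChar.map_add_eq_mul, Circle.coe_mul]
    ring

/-- If a neighborhood of the points `x - ∑ i ∈ T, u i` lies in `K`, there is a nonzero function with
spectrum in `K` vanishing on all the families. -/
theorem exists_hasSpectrumIn_vanishing {ι : Type*} [Fintype ι] [DecidableEq ι] {u : ι → E}
    (w : ι → E) (hu : ∀ i, u i ≠ 0) {K : Set E} {x : E} {ε : ℝ} (hε : 0 < ε)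
    (hK : ∀ T : Finset ι, Metric.ball (x - ∑ i ∈ T, u i) ε ⊆ K) :
    ∃ f, HasSpectrumIn K f ∧ f ≠ 0 ∧ ∀ i, ∀ r ∈ hyperplaneFamily (u i) (w i), f r = 0 := by
  set B := Metric.ball x ε with hB
  set F : E → ℂ := B.indicator fun _ => 1 with hF
  have hBfin : volume B ≠ ⊤ := measure_ball_lt_top.ne
  have hF2 : MemLp F 2 volume := memLp_indicator_const 2 measurableSet_ball 1 (Or.inr hBfin)
  have hF1 : Integrable F := 
    memLp_one_iff_integrable.1 (memLp_indicator_const 1 measurableSet_ball 1 (Or.inr hBfin))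
  have hg : HasSpectrumIn B (𝓕⁻ F) :=
    ⟨F, hF1, hF2, fun ξ hξ => Set.indicator_of_notMem hξ _, rfl⟩
  have hg0 : (𝓕⁻ F : E → ℂ) ≠ 0 := by
    intro h
    -- The value at the origin is the volume of the ball.
    have h0 := congrFun h 0
    rw [fourierInv_apply] at h0
    simp only [inner_zero_right, AddChar.map_zero_eq_one, Circle.coe_one, one_mul, hF,
      Pi.zero_apply] at h0
    rw [integral_indicator measurableSet_ball, setIntegral_const, smul_eq_zero] at h0
    rcases h0 with h0 | h0
    · exact (ENNReal.toReal_pos (Metric.measure_ball_pos volume x hε).ne' hBfin).ne' h0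
    · exact one_ne_zero h0
  refine ⟨_, (hg.mul_prod u w Finset.univ).mono ?_, mul_prod_ne_zero hu hg.continuous hg0 _, ?_⟩
  · rintro ξ ⟨T, -, h⟩
    apply hK T
    rw [hB, Metric.mem_ball, dist_eq_norm] at h
    rw [Metric.mem_ball, dist_eq_norm]
    convert h using 2
    abel
  · intro i r hr
    rw [Finset.prod_eq_zero (Finset.mem_univ i) (one_sub_fourierChar_eq_zero_iff.2 hr), mul_zero]

end Families

/-! ### A Bernstein-type estimate along lines -/

section Bernstein

/-- Provides a reproducing kernel: convolution with `φ` fixes functions of frequency at most `R`. -/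
theorem exists_schwartz_fourier_eq_one (R : ℝ) :
    ∃ φ : SchwartzMap ℝ ℂ, ∀ τ : ℝ, |τ| ≤ R → 𝓕 (φ : ℝ → ℂ) τ = 1 := by
  let b : ContDiffBump (0 : ℝ) := ⟨|R| + 1, |R| + 2, by positivity, by linarith⟩
  have hg₁ : HasCompactSupport (Complex.ofRealCLM ∘ b) := b.hasCompactSupport.comp_left rfl
  have hg₂ : ContDiff ℝ (⊤ : ℕ∞) (Complex.ofRealCLM ∘ b) := Complex.ofRealCLM.contDiff.comp b.contDiff
  set η : SchwartzMap ℝ ℂ := hg₁.toSchwartzMap hg₂ with hη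
  refine ⟨𝓕⁻ η, fun τ hτ => ?_⟩
  have h1 : (𝓕 ((𝓕⁻ η : SchwartzMap ℝ ℂ) : ℝ → ℂ) : ℝ → ℂ) = (η : ℝ → ℂ) := by
    rw [← SchwartzMap.fourier_coe, FourierTransform.fourier_fourierInv_eq]
  rw [h1]
  change ((b τ : ℝ) : ℂ) = 1
  rw [b.one_of_mem_closedBall, Complex.ofReal_one]
  rw [Metric.mem_closedBall, dist_zero_right, Real.norm_eq_abs]
  change |τ| ≤ |R| + 1
  linarith [le_abs_self R]

theorem exists_norm_schwartz_le_inv_one_add_sq (φ : SchwartzMap ℝ ℂ) :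
    ∃ C, 0 ≤ C ∧ ∀ x, ‖φ x‖ ≤ C * (1 + x ^ 2)⁻¹ := by
  obtain ⟨C₀, hC₀⟩ := φ.decay 0 0
  obtain ⟨C₂, hC₂⟩ := φ.decay 2 0
  simp only [norm_iteratedFDeriv_zero, pow_zero, one_mul] at hC₀ hC₂
  have h0 : 0 ≤ C₀ + C₂ := add_nonneg (hC₀.1.le) (hC₂.1.le)
  refine ⟨C₀ + C₂, h0, fun x => ?_⟩
  rw [← div_eq_mul_inv, le_div_iff₀ (by positivity)]
  have h1 := hC₀.2 x
  have h2 := hC₂.2 x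
  rw [Real.norm_eq_abs, sq_abs] at h2
  linarith

/-- Continuity of translations in `L¹` for a Schwartz function. -/
theorem tendsto_integral_norm_translate_sub (φ : SchwartzMap ℝ ℂ) :
    Filter.Tendsto (fun t : ℝ => ∫ s, ‖φ (t - s) - φ (-s)‖) (𝓝 0) (𝓝 0) := by
  obtain ⟨C, hC0, hC⟩ := exists_norm_schwartz_le_inv_one_add_sq φ
  have key : Filter.Tendsto (fun t : ℝ => ∫ s, ‖φ (t - s) - φ (-s)‖) (𝓝 0)
      (𝓝 (∫ s, ‖φ (0 - s) - φ (-s)‖)) := by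
    refine tendsto_integral_filter_of_dominated_convergence
      (fun s => 4 * C * (1 + s ^ 2)⁻¹) ?_ ?_ ?_ ?_
    · refine Filter.Eventually.of_forall fun t => ?_
      have := φ.continuous
      exact Continuous.aestronglyMeasurable (by fun_prop)
    · filter_upwards [Metric.ball_mem_nhds (0 : ℝ) one_pos] with t ht
      refine Filter.Eventually.of_forall fun s => ?_
      rw [Metric.mem_ball, dist_zero_right, Real.norm_eq_abs, abs_lt] at ht
      rw [norm_norm]
      -- For `|t| < 1` one has `s² ≤ 2(t - s)² + 2t²`, so `1 + s² ≤ 3(1 + (t - s)²)`.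
      have h1 : (1 + (t - s) ^ 2)⁻¹ ≤ 3 * (1 + s ^ 2)⁻¹ := by
        rw [← div_eq_mul_inv, inv_eq_one_div, div_le_div_iff₀ (by positivity) (by positivity)]
        nlinarith [sq_nonneg (s - 2 * (s - t)), sq_nonneg (t + (t - s)), ht.1, ht.2,
          sq_nonneg (2 * t - s), sq_nonneg (s - 3 / 2 * t)]
      have h2 : (1 + (-s) ^ 2)⁻¹ = (1 + s ^ 2)⁻¹ := by rw [neg_sq]
      calc ‖φ (t - s) - φ (-s)‖ ≤ ‖φ (t - s)‖ + ‖φ (-s)‖ := norm_sub_le _ _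
        _ ≤ C * (1 + (t - s) ^ 2)⁻¹ + C * (1 + (-s) ^ 2)⁻¹ := add_le_add (hC _) (hC _)
        _ ≤ C * (3 * (1 + s ^ 2)⁻¹) + C * (1 + s ^ 2)⁻¹ := by rw [h2]; gcongr
        _ = 4 * C * (1 + s ^ 2)⁻¹ := by ring
    · exact integrable_inv_one_add_sq.const_mul _
    · refine Filter.Eventually.of_forall fun s => ?_
      have := φ.continuous
      exact Continuous.tendsto (f := fun t => ‖φ (t - s) - φ (-s)‖) (by fun_prop) 0
  simpa using key

variable {E : Type*} [NormedAddCommGroup E] [InnerProductSpace ℝ E] [FiniteDimensional ℝ E]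
  [MeasurableSpace E] [BorelSpace E]

/-- Along the line, the frequency `ξ` becomes `⟪ξ, v⟫`, of size at most `R` where `F` can be
nonzero; there `𝓕 φ = 1`, and Fubini gives the convolution identity. -/
theorem fourierInv_line_eq_integral {R : ℝ} {φ : SchwartzMap ℝ ℂ}
    (hφ : ∀ τ : ℝ, |τ| ≤ R → 𝓕 (φ : ℝ → ℂ) τ = 1) {F : E → ℂ} (hF : Integrable F)
    (hFR : ∀ ξ, R < ‖ξ‖ → F ξ = 0) (x : E) {v : E} (hv : ‖v‖ ≤ 1) (t : ℝ) :
    𝓕⁻ F (x + t • v) = ∫ s, φ (t - s) * 𝓕⁻ F (x + s • v) := by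
  have hφi : Integrable fun s => φ (t - s) := φ.integrable.comp_sub_left t
  have hch : Continuous fun p : ℝ × E => (Real.fourierChar (inner ℝ p.2 (x + p.1 • v)) : ℂ) :=
    continuous_induced_dom.comp (Real.continuous_fourierChar.comp (by fun_prop))
  have hint : Integrable (fun p : ℝ × E =>
      φ (t - p.1) * ((Real.fourierChar (inner ℝ p.2 (x + p.1 • v)) : ℂ) * F p.2))
      (volume.prod volume) := by
    have h1 := (hφi.mul_prod hF).bdd_mul (c := 1) hch.aestronglyMeasurable
      (Filter.Eventually.of_forall fun _ => (Circle.norm_coe _).le)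
    refine h1.congr (Filter.Eventually.of_forall fun p => ?_)
    simp only
    ring
  simp only [fourierInv_apply, ← integral_const_mul]
  rw [integral_integral_swap hint]
  refine integral_congr_ae (Filter.Eventually.of_forall fun ξ => ?_)
  simp only
  by_cases hξ : R < ‖ξ‖
  · simp [hFR ξ hξ]
  have hτ : |inner ℝ ξ v| ≤ R := by
    calc |inner ℝ ξ v| ≤ ‖ξ‖ * ‖v‖ := abs_real_inner_le_norm _ _
      _ ≤ ‖ξ‖ * 1 := by gcongr
      _ ≤ R := by rw [mul_one]; exact not_lt.1 hξ
  have h2 := hφ _ hτ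
  rw [Real.fourier_eq] at h2
  rw [← integral_sub_left_eq_self (fun s => φ (t - s) * _) volume t]
  have h3 : ∀ s : ℝ, φ (t - (t - s)) *
      ((Real.fourierChar (inner ℝ ξ (x + (t - s) • v)) : ℂ) * F ξ) =
      ((Real.fourierChar (inner ℝ ξ (x + t • v)) : ℂ) * F ξ) *
        (Real.fourierChar (-inner ℝ s (inner ℝ ξ v)) • φ s) := by
    intro s
    have : inner ℝ ξ (x + (t - s) • v) = inner ℝ ξ (x + t • v) + -inner ℝ s (inner ℝ ξ v) := by
      simp only [inner_add_right, inner_smul_right, RCLike.inner_apply, conj_trivial]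
      ring
    rw [this, AddChar.map_add_eq_mul, Circle.coe_mul, Circle.smul_def, smul_eq_mul, sub_sub_cancel]
    ring
  simp only [h3]
  rw [integral_const_mul, h2, mul_one]

/-- A form of Bernstein's inequality along lines: a function with spectrum in a ball changes little
over short distances, relative to its supremum on the line. -/
theorem exists_norm_fourierInv_sub_le (R : ℝ) {ε : ℝ} (hε : 0 < ε) :
    ∃ δ > 0, ∀ F : E → ℂ, Integrable F → (∀ ξ, R < ‖ξ‖ → F ξ = 0) → ∀ (x y : E) (A : ℝ),
      (∀ t : ℝ, ‖𝓕⁻ F (x + t • (y - x))‖ ≤ A) → ‖y - x‖ ≤ δ → ‖𝓕⁻ F y - 𝓕⁻ F x‖ ≤ ε * A := by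
  obtain ⟨φ, hφ⟩ := exists_schwartz_fourier_eq_one R
  obtain ⟨δ, hδ, hδφ⟩ := Metric.tendsto_nhds_nhds.1 (tendsto_integral_norm_translate_sub φ) ε hε
  refine ⟨δ / 2, by positivity, fun F hF hFR x y A hA hxy => ?_⟩
  have hA0 : 0 ≤ A := (norm_nonneg _).trans (hA 0)
  by_cases hne : y = x
  · rw [hne, sub_self, norm_zero]; positivity
  have hn : 0 < ‖y - x‖ := norm_pos_iff.2 (sub_ne_zero.2 hne)
  set v : E := ‖y - x‖⁻¹ • (y - x) with hv
  have hv1 : ‖v‖ ≤ 1 := by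
    rw [hv, norm_smul, norm_inv, norm_norm, inv_mul_cancel₀ hn.ne']
  have hA' : ∀ s : ℝ, ‖𝓕⁻ F (x + s • v)‖ ≤ A := fun s => by
    rw [hv, smul_smul]; exact hA _
  have hy : y = x + ‖y - x‖ • v := by
    rw [hv, smul_smul, mul_inv_cancel₀ hn.ne', one_smul, add_sub_cancel]
  have hx : x = x + (0 : ℝ) • v := by simp
  have hcont : Continuous fun s : ℝ => 𝓕⁻ F (x + s • v) :=
    (continuous_fourierInv hF).comp (by fun_prop)
  have hi : ∀ t : ℝ, Integrable fun s => φ (t - s) * 𝓕⁻ F (x + s • v) := fun t =>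
    (φ.integrable.comp_sub_left t).mul_bdd (c := A) hcont.aestronglyMeasurable
      (Filter.Eventually.of_forall hA')
  have hd : Integrable fun s => ‖φ (‖y - x‖ - s) - φ (-s)‖ :=
    ((φ.integrable.comp_sub_left ‖y - x‖).sub φ.integrable.comp_neg).norm
  -- The reproducing identity at the two ends leaves a difference of translates of `φ`, small in
  -- `L¹`.
  have e : 𝓕⁻ F y - 𝓕⁻ F x = ∫ s, (φ (‖y - x‖ - s) - φ (-s)) * 𝓕⁻ F (x + s • v) := by
    nth_rewrite 1 [hy]
    nth_rewrite 3 [hx]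
    rw [fourierInv_line_eq_integral hφ hF hFR x hv1, fourierInv_line_eq_integral hφ hF hFR x hv1,
      ← integral_sub (hi _) (hi _)]
    simp only [zero_sub, sub_mul]
  rw [e]
  calc ‖∫ s, (φ (‖y - x‖ - s) - φ (-s)) * 𝓕⁻ F (x + s • v)‖
      ≤ ∫ s, ‖φ (‖y - x‖ - s) - φ (-s)‖ * A := by
        refine norm_integral_le_of_norm_le (hd.mul_const A)
          (Filter.Eventually.of_forall fun s => ?_)
        rw [norm_mul]
        gcongr
        exact hA' s
    _ = (∫ s, ‖φ (‖y - x‖ - s) - φ (-s)‖) * A := integral_mul_const _ _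
    _ ≤ ε * A := by
        gcongr
        have := hδφ (x := ‖y - x‖) (by
          rw [dist_zero_right, norm_norm]; linarith)
        rw [dist_zero_right, Real.norm_eq_abs] at this
        exact (le_abs_self _).trans this.le

end Bernstein

/-! ### From a fine net to the whole hyperplanes -/

section Propagation

variable {E : Type*} [NormedAddCommGroup E] [InnerProductSpace ℝ E]

theorem mem_hyperplaneFamily_of_inner_eq_zero {u w x y : E} (hx : x ∈ hyperplaneFamily u w)
    (hy : inner ℝ y u = 0) : x + y ∈ hyperplaneFamily u w := by
  obtain ⟨j, hj⟩ := hx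
  exact ⟨j, by rw [add_sub_right_comm, inner_add_left, hy, add_zero, hj]⟩

/-- Nearby points of two of the hyperplane families are joined by a short path inside them. -/
theorem exists_corner_near {ι : Type*} {u : ι → E} (w : ι → E) (hu : LinearIndependent ℝ u)
    {δ : ℝ} (hδ : 0 < δ) (i j : ι) :
    ∃ ρ > 0, ∀ x ∈ hyperplaneFamily (u i) (w i), ∀ z ∈ hyperplaneFamily (u j) (w j), ‖z - x‖ ≤ ρ →
      ∃ y, inner ℝ (y - x) (u i) = 0 ∧ inner ℝ (y - z) (u j) = 0 ∧ ‖y - x‖ ≤ δ ∧ ‖y - z‖ ≤ δ := by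
  by_cases hij : i = j
  · subst hij
    have hn : 0 < ‖u i‖ := norm_pos_iff.2 (hu.ne_zero i)
    -- Hyperplanes of one family are `1 / ‖u i‖` apart, so points within half that distance share a
    -- hyperplane and `y = z` works.
    refine ⟨min δ (1 / (2 * ‖u i‖)), by positivity, fun x ⟨k, hk⟩ z ⟨l, hl⟩ hzx => ⟨z, ?_, by simp,
      hzx.trans (min_le_left _ _), by simpa using hδ.le⟩⟩
    have h1 : inner ℝ (z - x) (u i) = ((l - k : ℤ) : ℝ) := by
      push_cast
      rw [← hk, ← hl, ← inner_sub_left, sub_sub_sub_cancel_right]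
    have h2 : |inner ℝ (z - x) (u i)| < 1 := by
      calc |inner ℝ (z - x) (u i)| ≤ ‖z - x‖ * ‖u i‖ := abs_real_inner_le_norm _ _
        _ ≤ 1 / (2 * ‖u i‖) * ‖u i‖ := by gcongr; exact hzx.trans (min_le_right _ _)
        _ = 1 / 2 := by field_simp
        _ < 1 := by norm_num
    rw [h1] at h2 ⊢
    have h3 : |l - k| < 1 := by exact_mod_cast h2
    rw [Int.abs_lt_one_iff.1 h3, Int.cast_zero]
  · obtain ⟨v, hv0, hv⟩ := exists_inner_eq_zero_and_ne_zero hu (Ne.symm hij)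
    set C := ‖u j‖ * ‖v‖ / |inner ℝ v (u j)| with hC
    have hC0 : 0 ≤ C := by positivity
    -- Starting at `x`, move along `v`, inside the hyperplane of `x`, until the hyperplane of `z` is
    -- reached. `C` bounds the length of this move relative to `‖z - x‖`.
    refine ⟨δ / (1 + C), by positivity, fun x _ z _ hzx =>
      ⟨x + (inner ℝ (z - x) (u j) / inner ℝ v (u j)) • v, ?_, ?_, ?_⟩⟩
    · rw [add_sub_cancel_left, inner_smul_left, hv0, mul_zero]
    · rw [add_sub_right_comm, inner_add_left, inner_smul_left, conj_trivial, div_mul_cancel₀ _ hv,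
        ← inner_add_left]
      simp
    · have h1 : ‖(inner ℝ (z - x) (u j) / inner ℝ v (u j)) • v‖ ≤ C * ‖z - x‖ := by
        rw [norm_smul, Real.norm_eq_abs, abs_div, hC]
        calc |inner ℝ (z - x) (u j)| / |inner ℝ v (u j)| * ‖v‖
            ≤ (‖z - x‖ * ‖u j‖) / |inner ℝ v (u j)| * ‖v‖ := by
              gcongr; exact abs_real_inner_le_norm _ _
          _ = _ := by ring
      have h2 : (1 + C) * ‖z - x‖ ≤ δ := by
        rw [le_div_iff₀ (by positivity)] at hzx
        linarith
      have h3 := norm_nonneg (z - x)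
      rw [add_sub_cancel_left, add_sub_right_comm]
      refine ⟨by nlinarith, (norm_add_le _ _).trans ?_⟩
      rw [norm_sub_rev x z]
      nlinarith

variable [FiniteDimensional ℝ E] [MeasurableSpace E] [BorelSpace E]

/-- A function with bounded spectrum that vanishes at sufficiently dense points of the union of the
hyperplane families vanishes on the whole union. -/
theorem exists_density_forall_eq_zero {ι : Type*} [Finite ι] {u : ι → E} (w : ι → E)
    (hu : LinearIndependent ℝ u) {K : Set E} (hK : Bornology.IsBounded K) :
    ∃ ρ > 0, ∀ Λ : Set E, Λ ⊆ (⋃ i, hyperplaneFamily (u i) (w i)) →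
      (∀ x ∈ ⋃ i, hyperplaneFamily (u i) (w i), ∃ z ∈ Λ, ‖z - x‖ ≤ ρ) →
      ∀ f : E → ℂ, HasSpectrumIn K f → (∀ z ∈ Λ, f z = 0) →
      ∀ x ∈ ⋃ i, hyperplaneFamily (u i) (w i), f x = 0 := by
  obtain ⟨R, hR⟩ := hK.exists_norm_le
  obtain ⟨δ, hδ, hB⟩ := exists_norm_fourierInv_sub_le (E := E) R (ε := 1 / 4) (by norm_num)
  choose ρ hρ0 hρ using exists_corner_near w hu hδ
  obtain ⟨ρ₀, hρ₀, hpos⟩ : ∃ ρ₀ : ℝ, (∀ i j, ρ₀ ≤ ρ i j) ∧ 0 < ρ₀ := by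
    have h : ∀ᶠ r : ℝ in 𝓝[>] 0, ∀ i j, r ≤ ρ i j := by
      simp only [Filter.eventually_all]
      intro i j
      exact nhdsWithin_le_nhds (eventually_le_nhds (hρ0 i j))
    exact (h.and self_mem_nhdsWithin).exists
  refine ⟨ρ₀, hpos, fun Λ hΛ hdense f hf hfΛ => ?_⟩
  obtain ⟨F, hF, -, hFK, rfl⟩ := hf
  have hFR : ∀ ξ, R < ‖ξ‖ → F ξ = 0 := fun ξ hξ =>
    hFK ξ fun h => absurd (hR ξ h) (not_le.2 hξ)
  -- Go from `x` to `y` and from `y` to a zero `z`. Both lines stay in the hyperplanes, where `A` is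
  -- a bound, so each leg costs at most `A / 4`.
  have hhalf : ∀ A : ℝ, (∀ x ∈ ⋃ i, hyperplaneFamily (u i) (w i), ‖𝓕⁻ F x‖ ≤ A) →
      ∀ x ∈ ⋃ i, hyperplaneFamily (u i) (w i), ‖𝓕⁻ F x‖ ≤ A / 2 := by
    intro A hA x hx
    obtain ⟨z, hz, hzx⟩ := hdense x hx
    obtain ⟨i, hi⟩ := Set.mem_iUnion.1 hx
    obtain ⟨j, hj⟩ := Set.mem_iUnion.1 (hΛ hz)
    obtain ⟨y, hyx, hyz, hdx, hdz⟩ := hρ i j x hi z hj (hzx.trans (hρ₀ i j))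
    have h1 := hB F hF hFR x y A (fun t => hA _ (Set.mem_iUnion.2 ⟨i,
      mem_hyperplaneFamily_of_inner_eq_zero hi (by rw [inner_smul_left, hyx, mul_zero])⟩)) hdx
    have h2 := hB F hF hFR z y A (fun t => hA _ (Set.mem_iUnion.2 ⟨j,
      mem_hyperplaneFamily_of_inner_eq_zero hj (by rw [inner_smul_left, hyz, mul_zero])⟩)) hdz
    rw [hfΛ z hz, sub_zero] at h2
    have h3 : ‖𝓕⁻ F x‖ ≤ ‖𝓕⁻ F y‖ + ‖𝓕⁻ F y - 𝓕⁻ F x‖ := by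
      have := norm_sub_le (𝓕⁻ F y) (𝓕⁻ F y - 𝓕⁻ F x)
      rwa [sub_sub_cancel] at this
    linarith
  have hpow : ∀ n : ℕ, ∀ x ∈ ⋃ i, hyperplaneFamily (u i) (w i),
      ‖𝓕⁻ F x‖ ≤ (∫ ξ, ‖F ξ‖) * (1 / 2) ^ n := by
    intro n
    induction n with
    | zero =>
      intro x _
      rw [pow_zero, mul_one, fourierInv_apply]
      refine (norm_integral_le_integral_norm _).trans_eq ?_
      simp only [norm_mul, Circle.norm_coe, one_mul]
    | succ n ih =>
      intro x hx
      have := hhalf _ ih x hx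
      rw [pow_succ]
      linarith
  intro x hx
  have hlim : Filter.Tendsto (fun n : ℕ => (∫ ξ, ‖F ξ‖) * (1 / 2 : ℝ) ^ n) Filter.atTop (𝓝 0) := by
    simpa using (tendsto_pow_atTop_nhds_zero_of_lt_one (by norm_num : (0 : ℝ) ≤ 1 / 2)
      (by norm_num)).const_mul (∫ ξ, ‖F ξ‖)
  exact norm_le_zero_iff.1 (ge_of_tendsto' hlim fun n => hpow n x hx)

end Propagation

/-! ### Hyperplanes as manifolds, separated nets and corners -/

section Geometry

theorem sUnion_uniformHyperplaneSet {d : ℕ} (w : EuclideanSpace ℝ (Fin d))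
    {h : EuclideanSpace ℝ (Fin d)} (hh : ‖h‖ = 1) {Δ : ℝ} (hΔ : 0 < Δ) :
    ⋃₀ uniformHyperplaneSet w h Δ = hyperplaneFamily (Δ⁻¹ • h) w := by
  have hhh : inner ℝ h h = 1 := by rw [real_inner_self_eq_norm_sq, hh, one_pow]
  ext r
  simp only [uniformHyperplaneSet, Set.sUnion_range, Set.mem_iUnion, hyperplaneFamily]
  refine exists_congr fun j => ⟨?_, fun hj => ⟨r - w - ((j : ℝ) * Δ) • h, ?_, ?_⟩⟩
  · rintro ⟨v, hv, rfl⟩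
    have hv' : inner ℝ v h = 0 := hv
    rw [show w + ((j : ℝ) * Δ) • h + v - w = ((j : ℝ) * Δ) • h + v by abel, inner_smul_right,
      inner_add_left, inner_smul_left, hv', hhh, conj_trivial]
    field_simp
    ring
  · change inner ℝ (r - w - ((j : ℝ) * Δ) • h) h = 0
    rw [inner_smul_right, inv_mul_eq_iff_eq_mul₀ hΔ.ne'] at hj
    rw [inner_sub_left, inner_smul_left, hhh, hj, conj_trivial]
    ring
  · change w + ((j : ℝ) * Δ) • h + (r - w - ((j : ℝ) * Δ) • h) = r
    abel

theorem sUnion_unionUniformHyperplaneSets {d N : ℕ} (w : Fin N → EuclideanSpace ℝ (Fin d))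
    {h : Fin N → EuclideanSpace ℝ (Fin d)} (hh : ∀ i, ‖h i‖ = 1) {Δ : Fin N → ℝ}
    (hΔ : ∀ i, 0 < Δ i) :
    ⋃₀ unionUniformHyperplaneSets w h Δ = ⋃ i, hyperplaneFamily ((Δ i)⁻¹ • h i) (w i) := by
  rw [unionUniformHyperplaneSets, Set.sUnion_iUnion]
  exact Set.iUnion_congr fun i => sUnion_uniformHyperplaneSet (w i) (hh i) (hΔ i)

theorem isManifoldIn_of_homeomorph {d κ : ℕ} {M : Set (EuclideanSpace ℝ (Fin d))}
    (e : M ≃ₜ EuclideanSpace ℝ (Fin κ)) : IsManifoldIn κ M :=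
  fun _ => ⟨Set.univ, Filter.univ_mem, ⟨(Homeomorph.Set.univ M).trans e⟩⟩

theorem isManifoldIn_translate_originHyperplane {d : ℕ} (a : EuclideanSpace ℝ (Fin d))
    {h : EuclideanSpace ℝ (Fin d)} (hh : h ≠ 0) :
    IsManifoldIn (d - 1) ((fun r => a + r) '' originHyperplane h) := by
  have hset : originHyperplane h = ((Submodule.span ℝ {h})ᗮ : Set (EuclideanSpace ℝ (Fin d))) := by
    ext r
    exact Submodule.mem_orthogonal_singleton_iff_inner_left.symm
  have hdim : Module.finrank ℝ (Submodule.span ℝ {h})ᗮ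
      = Module.finrank ℝ (EuclideanSpace ℝ (Fin (d - 1))) := by
    have h1 := (Submodule.span ℝ {h}).finrank_add_finrank_orthogonal
    rw [finrank_span_singleton hh, finrank_euclideanSpace_fin] at h1
    rw [finrank_euclideanSpace_fin]
    omega
  let e₁ : ((fun r => a + r) '' originHyperplane h) ≃ₜ originHyperplane h :=
    ((Homeomorph.addLeft a).image (originHyperplane h)).symm
  let e₂ : originHyperplane h ≃ₜ (Submodule.span ℝ {h})ᗮ := Homeomorph.setCongr hset
  exact isManifoldIn_of_homeomorph
    ((e₁.trans e₂).trans (ContinuousLinearEquiv.ofFinrankEq hdim).toHomeomorph)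

theorem isManifoldSet_unionUniformHyperplaneSets {d N : ℕ}
    (w : Fin N → EuclideanSpace ℝ (Fin d)) {h : Fin N → EuclideanSpace ℝ (Fin d)}
    (hh : ∀ i, ‖h i‖ = 1) (Δ : Fin N → ℝ) :
    IsManifoldSet (d - 1) (unionUniformHyperplaneSets w h Δ) := by
  refine ⟨Set.countable_iUnion fun i => Set.countable_range _, fun M hM => ?_⟩
  obtain ⟨i, j, rfl⟩ := Set.mem_iUnion.1 hM
  refine isManifoldIn_translate_originHyperplane _ fun h0 => ?_
  have := hh i
  rw [h0, norm_zero] at this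
  exact zero_ne_one this

/-- A maximal `ρ`-separated subset, given by Zorn's lemma, is automatically a `ρ`-net. -/
theorem exists_uniformlyDiscrete_dense {d : ℕ} (P : Set (EuclideanSpace ℝ (Fin d))) {ρ : ℝ}
    (hρ : 0 < ρ) :
    ∃ Λ ⊆ P, UniformlyDiscrete Λ ∧ ∀ x ∈ P, ∃ z ∈ Λ, ‖z - x‖ ≤ ρ := by
  obtain ⟨Λ, hΛ⟩ := zorn_subset {N | N ⊆ P ∧ N.Pairwise fun x y => ρ < ‖x - y‖} (by
    intro c hc hchain
    refine ⟨⋃₀ c, ⟨Set.sUnion_subset fun s hs => (hc hs).1, ?_⟩, fun s hs =>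
      Set.subset_sUnion_of_mem hs⟩
    exact (Set.pairwise_sUnion hchain.directedOn).2 fun s hs => (hc hs).2)
  refine ⟨Λ, hΛ.prop.1, ⟨ρ, hρ, fun x hx y hy hxy => hΛ.prop.2 hx hy hxy⟩, fun x hx => ?_⟩
  by_contra! hc
  have hmem : x ∈ Λ := hΛ.le_of_ge (y := insert x Λ)
    ⟨Set.insert_subset hx hΛ.prop.1, hΛ.prop.2.insert fun z hz _ =>
      ⟨by rw [norm_sub_rev]; exact hc z hz, hc z hz⟩⟩ (Set.subset_insert x Λ)
    (Set.mem_insert x Λ)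
  have := hc x hmem
  rw [sub_self, norm_zero] at this
  exact hρ.not_gt this

/-- `T` collects the indices with sign `-1`: flipping one sign subtracts a full shift `2π h i / Δ i`
from the all-plus corner. -/
theorem mem_cornerSet_iff {d N : ℕ} {h : Fin N → EuclideanSpace ℝ (Fin d)} {Δ : Fin N → ℝ}
    {q : EuclideanSpace ℝ (Fin d)} :
    q ∈ cornerSet h Δ ↔ ∃ T : Finset (Fin N),
      q = ∑ i, (1 / 2 : ℝ) • spectralShift (h i) (Δ i) -
        (2 * Real.pi) • ∑ i ∈ T, (Δ i)⁻¹ • h i := by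
  have key : ∀ (k : Fin N → Fin 2) (T : Finset (Fin N)), (∀ i, i ∈ T ↔ k i = 1) →
      ∑ i, (-1 : ℝ) ^ (k i : ℕ) • ((1 / 2 : ℝ) • spectralShift (h i) (Δ i)) =
        ∑ i, (1 / 2 : ℝ) • spectralShift (h i) (Δ i) -
        (2 * Real.pi) • ∑ i ∈ T, (Δ i)⁻¹ • h i := by
    intro k T hT
    have hsum : ∑ i ∈ T, (Δ i)⁻¹ • h i = ∑ i, if i ∈ T then (Δ i)⁻¹ • h i else 0 := by
      rw [Finset.sum_ite_mem, Finset.univ_inter]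
    rw [hsum, Finset.smul_sum, ← Finset.sum_sub_distrib]
    refine Finset.sum_congr rfl fun i _ => ?_
    by_cases hi : i ∈ T
    · rw [(hT i).1 hi, if_pos hi, spectralShift, div_eq_mul_inv]
      simp only [Fin.val_one, pow_one]
      module
    · have hk : k i = 0 := by
        by_contra h0
        exact hi ((hT i).2 (Fin.eq_one_of_ne_zero _ h0))
      rw [hk, if_neg hi]
      simp
  constructor
  · rintro ⟨k, rfl⟩
    exact ⟨Finset.univ.filter fun i => k i = 1, key k _ fun i => by simp⟩
  · rintro ⟨T, rfl⟩
    classical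
    exact ⟨fun i => if i ∈ T then 1 else 0, (key _ T fun i => by by_cases hi : i ∈ T <;> simp [hi]).symm⟩

end Geometry

/-! ### The two halves of the theorem -/

section Nyquist

/-- The hyperplanes carry a sampling set when no translate of `Ω` contains the corner set. -/
theorem exists_samplingSet_of_forall_not_cornerSet_subset {d N : ℕ}
    {Ω : Set (EuclideanSpace ℝ (Fin d))} (hΩ_compact : IsCompact Ω) (hΩ_convex : Convex ℝ Ω)
    (w : Fin N → EuclideanSpace ℝ (Fin d)) {h : Fin N → EuclideanSpace ℝ (Fin d)}
    {Δ : Fin N → ℝ} (hh : ∀ i, ‖h i‖ = 1) (hΔ : ∀ i, 0 < Δ i) (hind : LinearIndependent ℝ h)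
    (hQ : ∀ s : EuclideanSpace ℝ (Fin d), ¬ cornerSet h Δ ⊆ shift Ω s) :
    ∃ Λ ⊆ ⋃₀ unionUniformHyperplaneSets w h Δ, Λ ∈ SamplingSets Ω := by
  set u : Fin N → EuclideanSpace ℝ (Fin d) := fun i => (Δ i)⁻¹ • h i with hu_def
  have hu : LinearIndependent ℝ u :=
    hind.units_smul fun i => Units.mk0 (Δ i)⁻¹ (inv_ne_zero (hΔ i).ne')
  have hP : ⋃₀ unionUniformHyperplaneSets w h Δ = ⋃ i, hyperplaneFamily (u i) (w i) :=
    sUnion_unionUniformHyperplaneSets w hh hΔ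
  have hpi : 2 * Real.pi ≠ 0 := by positivity
  set K : Set (EuclideanSpace ℝ (Fin d)) := {ξ | (2 * Real.pi) • ξ ∈ Ω} with hK
  have hKcomp : IsCompact K :=
    (Homeomorph.smulOfNeZero (2 * Real.pi) hpi).isCompact_preimage.2 hΩ_compact
  have hKconv : Convex ℝ K := hΩ_convex.smul_preimage (2 * Real.pi)
  obtain ⟨ρ, hρ, hdens⟩ := exists_density_forall_eq_zero w hu hKcomp.isBounded
  obtain ⟨Λ, hΛP, hΛu, hΛd⟩ := exists_uniformlyDiscrete_dense
    (⋃ i, hyperplaneFamily (u i) (w i)) hρ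
  refine ⟨Λ, hP ▸ hΛP, hΛu, fun f hf g hg hfg => ?_⟩
  have hspec := (hasSpectrumIn_of_bandlimited hΩ_compact.isBounded hΩ_compact.measurableSet hf).sub
    (hasSpectrumIn_of_bandlimited hΩ_compact.isBounded hΩ_compact.measurableSet hg)
  have hvan := hdens Λ hΛP hΛd _ hspec fun z hz => sub_eq_zero.2 (hfg z hz)
  by_contra hne
  obtain ⟨x, hx⟩ := exists_forall_sub_sum_mem w hu Finset.univ hKconv hKcomp hspec
    (fun i _ r hr => hvan r (Set.mem_iUnion.2 ⟨i, hr⟩)) fun h0 => hne (by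
      ext r; exact sub_eq_zero.1 (congrFun h0 r))
  -- This translation carries `2π(x - ∑ i ∈ T, u i)` to the corner indexed by `T`.
  refine hQ (∑ i, (1 / 2 : ℝ) • spectralShift (h i) (Δ i) - (2 * Real.pi) • x) fun q hq => ?_
  obtain ⟨T, rfl⟩ := mem_cornerSet_iff.1 hq
  have hT : (2 * Real.pi) • (x - ∑ i ∈ T, u i) ∈ Ω := hx T (Finset.subset_univ T)
  change _ - _ ∈ Ω
  rwa [sub_sub_sub_cancel_left, ← smul_sub]

/-- No subset of the hyperplanes is a sampling set when a translate of the interior of `Ω` contains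
the corner set. -/
theorem notMem_samplingSets_of_cornerSet_subset_interior {d N : ℕ}
    {Ω : Set (EuclideanSpace ℝ (Fin d))}
    (w : Fin N → EuclideanSpace ℝ (Fin d)) {h : Fin N → EuclideanSpace ℝ (Fin d)}
    {Δ : Fin N → ℝ} (hh : ∀ i, ‖h i‖ = 1) (hΔ : ∀ i, 0 < Δ i) (hind : LinearIndependent ℝ h)
    {s : EuclideanSpace ℝ (Fin d)} (hs : cornerSet h Δ ⊆ shift (interior Ω) s)
    {Λ : Set (EuclideanSpace ℝ (Fin d))} (hΛ : Λ ⊆ ⋃₀ unionUniformHyperplaneSets w h Δ) :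
    Λ ∉ SamplingSets Ω := by
  rintro ⟨-, hdet⟩
  set u : Fin N → EuclideanSpace ℝ (Fin d) := fun i => (Δ i)⁻¹ • h i with hu_def
  have hu : LinearIndependent ℝ u :=
    hind.units_smul fun i => Units.mk0 (Δ i)⁻¹ (inv_ne_zero (hΔ i).ne')
  have hP : ⋃₀ unionUniformHyperplaneSets w h Δ = ⋃ i, hyperplaneFamily (u i) (w i) :=
    sUnion_unionUniformHyperplaneSets w hh hΔ
  have hpi : 2 * Real.pi ≠ 0 := by positivity
  set K : Set (EuclideanSpace ℝ (Fin d)) := {ξ | (2 * Real.pi) • ξ ∈ Ω} with hK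
  -- The same correspondence solved for `x`: the all-plus corner, moved back by `s` and rescaled.
  set x := (2 * Real.pi)⁻¹ • (∑ i, (1 / 2 : ℝ) • spectralShift (h i) (Δ i) - s) with hx
  have hball : ∀ T : Finset (Fin N), ∃ ε > 0, Metric.ball (x - ∑ i ∈ T, u i) ε ⊆ K := by
    intro T
    have hmem : (2 * Real.pi) • (x - ∑ i ∈ T, u i) ∈ interior Ω := by
      have : _ - s ∈ interior Ω := hs (mem_cornerSet_iff.2 ⟨T, rfl⟩)
      rwa [smul_sub, hx, smul_smul, mul_inv_cancel₀ hpi, one_smul, sub_right_comm]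
    refine Metric.mem_nhds_iff.1 ?_
    exact (continuous_const_smul (2 * Real.pi)).continuousAt.preimage_mem_nhds
      (mem_interior_iff_mem_nhds.1 hmem)
  choose ε hε0 hε using hball
  obtain ⟨ε₀, hle, hpos⟩ : ∃ ε₀ : ℝ, (∀ T, ε₀ ≤ ε T) ∧ 0 < ε₀ := by
    have h : ∀ᶠ r : ℝ in 𝓝[>] 0, ∀ T, r ≤ ε T := by
      rw [Filter.eventually_all]
      exact fun T => nhdsWithin_le_nhds (eventually_le_nhds (hε0 T))
    exact (h.and self_mem_nhdsWithin).exists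
  obtain ⟨f, hf, hne, hf0⟩ := exists_hasSpectrumIn_vanishing w hu.ne_zero hpos
    fun T => (Metric.ball_subset_ball (hle T)).trans (hε T)
  refine hne (hdet f (bandlimited_of_hasSpectrumIn hf) 0 (bandlimited_of_hasSpectrumIn ?_) ?_)
  · convert hf.sub hf using 1
    ext r
    simp
  · intro z hz
    obtain ⟨i, hi⟩ := Set.mem_iUnion.1 (hP ▸ hΛ hz)
    exact hf0 i z hi

end Nyquist

end HyperplaneSampling

theorem theorem5 (d : ℕ) (hd : 1 ≤ d) (Ω : Set (EuclideanSpace ℝ (Fin d)))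
    (hΩ_compact : IsCompact Ω) (hΩ_convex : Convex ℝ Ω)
    (N : ℕ) (w h : Fin N → EuclideanSpace ℝ (Fin d)) (Δ : Fin N → ℝ)
    (hh : ∀ i, ‖h i‖ = 1) (hΔ : ∀ i, 0 < Δ i) (hind : LinearIndependent ℝ h) :
    HyperplaneSampling.IsManifoldSet (d - 1)
        (HyperplaneSampling.unionUniformHyperplaneSets w h Δ) ∧
    ((∀ s : EuclideanSpace ℝ (Fin d),
        ¬ HyperplaneSampling.cornerSet h Δ ⊆ HyperplaneSampling.shift Ω s) →
      HyperplaneSampling.unionUniformHyperplaneSets w h Δ ∈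
        HyperplaneSampling.NyquistManifoldSets (d - 1) Ω) ∧
    ((∃ s : EuclideanSpace ℝ (Fin d),
        HyperplaneSampling.cornerSet h Δ ⊆ HyperplaneSampling.shift (interior Ω) s) →
      HyperplaneSampling.unionUniformHyperplaneSets w h Δ ∉
        HyperplaneSampling.NyquistManifoldSets (d - 1) Ω) :=
  have hM := HyperplaneSampling.isManifoldSet_unionUniformHyperplaneSets w hh Δ
  ⟨hM,
    fun hQ => ⟨hM, HyperplaneSampling.exists_samplingSet_of_forall_not_cornerSet_subset
      hΩ_compact hΩ_convex w hh hΔ hind hQ⟩,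
    fun ⟨_, hs⟩ ⟨_, _, hΛ, hdet⟩ =>
      HyperplaneSampling.notMem_samplingSets_of_cornerSet_subset_interior w hh hΔ hind hs hΛ hdet⟩
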